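/- **Conventions.** A pregeometry $(X,*,\mathrm{typ})$ over $I$ consists of a set $X$, a reflexive symmetric incidence relation $*$ and a map $\mathrm{typ}:X\to I$ such that incident elements of the same type are equal. A flag is a set of pairwise incident elements; a chamber is a flag containing an element of every type; a geometry is a pregeometry in which every flag is contained in a chamber. The residue of a flag $F$ consists of the elements not in $F$ that are incident with all elements of $F$. The basic diagram is the graph on $I$ in which $i\ne j$ are adjacent if and only if some residue of a flag of type $I\setminus\{i,j\}$ is not a generalised digon (i.e. has non-incident elements of types $i$ and $j$). The direct sum property says that every residue of a flag is isomorphic to the direct sum of its truncations to the connected components of its diagram. The fundamental group $\pi_1(\Gamma)$ is the group of closed paths of the incidence graph at a base point, modulo insertion and deletion of returns and triangles; $\Gamma$ is simply connected if it is connected and $\pi_1(\Gamma)=1$. A covering is a surjective type- and incidence-preserving map that is an isomorphism from the residue of every nonempty flag onto the residue of the image of that flag; it is universal if it factors through every covering of $\Gamma$ by a connected geometry, uniquely once base points are chosen. **Theorem (Covering Theorem).** Let $\Gamma=(X,*,\mathrm{typ})$ be a connected geometry over $I=\{1,2,3\}$ with the direct sum property whose basic diagram $\Delta$ is the path $1 -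 2 - 3$. Let $G$ be a group of (type-preserving) automorphisms of $\Gamma$ that is transitive on the elements of each type and transitive on the flags of type $\{1,2\}$ and on the flags of type $\{2,3\}$. Let $\{w^1,w^2,w^3\}$ be a flag with $\mathrm{typ}(w^i)=i$, and let $g\in G_{w^2}$ be such that every element of type $3$ incident with $w^1$ and $w^2$ lies in the $G_{w^1,w^2}$-orbit of $w^3$ or of $gw^3$, and such that the incident pairs $(w^1,w^3)$ and $(w^1,gw^3)$ lie in different $G$-orbits (in particular $w^3$ and $gw^3$ represent exactly two $G_{w^1,w^2}$-orbits on these elements). Let $\mathcal A$ be the fused amalgam of parabolics: its members are the pointwise stabilisers $G_S$ of the nonempty flags $S\subseteq\{w^1,w^2,w^3,gw^3\}$, i.e. of the nonempty subsets not containing both $w^3$ and $gw^3$; its maps are the inclusions; and its fusion is $\gamma:G_{w^3}\to G_{gw^3}$, $x\mapsto gxg^{-1}$, with $g\in G_{w^2}$. Let $\mathcal U(\mathcal A)$ be its universal enveloping group, generated by symbols $u_x$ ($x$ in the disjoint union of the members of $\mathcal A$) subject to $u_xu_y=u_{xy}$ for $x,y$ in the same member, $u_x=u_{\phi(x)}$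 for every inclusion $\phi$ of $\mathcal A$, and $u_{\gamma(x)}=u_gu_xu_g^{-1}$ for $x\in G_{w^3}$ (where $g$ is taken in the member $G_{w^2}$). Let $\hat\Gamma$ be the diagram coset pregeometry of $\mathcal U(\mathcal A)$ with respect to the images of $G_{w^1},G_{w^2},G_{w^3}$: its elements of type $i$ are the left cosets of the image of $G_{w^i}$; cosets of types $1,2$ or $2,3$ are incident if and only if they meet; a coset of type $1$ and a coset of type $3$ are incident if and only if some coset of type $2$ meets both; cosets of the same type are incident only if they are equal. Then $\hat\Gamma$ is a simply connected geometry; the natural homomorphism $\psi:\mathcal U(\mathcal A)\to G$ is surjective; and $uG_{w^i}\mapsto\psi(u)w^i$ is a well-defined universal covering $\hat\Gamma\to\Gamma$. Moreover $\mathcal U(\mathcal A)$ is of the form $\pi_1(\Gamma).G$: there is an extension $1\to\pi_1(\Gamma)\to\mathcal U(\mathcal A)\xrightarrow{\ \psi\ }G\to1$. -/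

import Mathlib

universe u v w

/-- A pregeometry over the type set `I` with set of elements `X`: a reflexive and symmetric
incidence relation and a type function such that incident elements of equal type are equal. -/
structure Pregeometry (X : Type*) (I : Type*) where
  Inc : X → X → Prop
  typ : X → I
  inc_refl : ∀ x, Inc x x
  inc_symm : ∀ {x y}, Inc x y → Inc y x
  eq_of_inc : ∀ {x y}, Inc x y → typ x = typ y → x = y

namespace Pregeometry

variable {X Y I : Type*}

/-- A flag is a set of pairwise incident elements. -/
def IsFlag (Γ : Pregeometry X I) (F : Set X) : Prop :=
  ∀ x ∈ F, ∀ y ∈ F, Γ.Inc x y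

/-- A chamber is a flag that contains an element of every type. -/
def IsChamber (Γ : Pregeometry X I) (C : Set X) : Prop :=
  Γ.IsFlag C ∧ Γ.typ '' C = Set.univ

/-- A geometry is a pregeometry in which every flag is contained in a chamber. -/
def IsGeometry (Γ : Pregeometry X I) : Prop :=
  ∀ F, Γ.IsFlag F → ∃ C, Γ.IsChamber C ∧ F ⊆ C

/-- The set of elements of the residue of `F`. -/
def residueSet (Γ : Pregeometry X I) (F : Set X) : Set X :=
  {x | x ∉ F ∧ ∀ y ∈ F, Γ.Inc x y}

/-- The residue of `F`, as a pregeometry over the types that do not occur in `F`. -/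
def residue (Γ : Pregeometry X I) (F : Set X) :
    Pregeometry (Γ.residueSet F) {i : I // i ∉ Γ.typ '' F} where
  Inc x y := Γ.Inc x y
  typ x := ⟨Γ.typ x, fun ⟨y, hy, h⟩ => x.2.1 (Γ.eq_of_inc (x.2.2 y hy) h.symm ▸ hy)⟩
  inc_refl x := Γ.inc_refl x
  inc_symm h := Γ.inc_symm h
  eq_of_inc h e := Subtype.ext (Γ.eq_of_inc h (congrArg Subtype.val e))

/-- The basic diagram: distinct types `i` and `j` are adjacent if and only if the residue of some
flag of type `I \ {i, j}` is not a generalised digon, that is, has an element of type `i` and an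
element of type `j` that are not incident. -/
def basicDiagram (Γ : Pregeometry X I) : SimpleGraph I where
  Adj i j := i ≠ j ∧ ∃ F, Γ.IsFlag F ∧ Γ.typ '' F = {i, j}ᶜ ∧
    ∃ x ∈ Γ.residueSet F, ∃ y ∈ Γ.residueSet F, Γ.typ x = i ∧ Γ.typ y = j ∧ ¬ Γ.Inc x y
  symm := ⟨by
    rintro i j ⟨hij, F, hF, hty, x, hx, y, hy, hxi, hyj, hn⟩
    exact ⟨hij.symm, F, hF, by rw [hty, Set.pair_comm], y, hy, x, hx, hyj, hxi,
      fun h => hn (Γ.inc_symm h)⟩⟩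
  loopless := ⟨fun i h => h.1 rfl⟩

/-- The direct sum of the truncations of `Γ` to the connected components of its basic diagram.
Its set of elements is again `X`, the disjoint union of the element sets of the truncations;
elements of the same truncation are incident if they are so in `Γ`, and elements of different
truncations are always incident. -/
def sumOfComponents (Γ : Pregeometry X I) : Pregeometry X I where
  Inc x y := Γ.basicDiagram.Reachable (Γ.typ x) (Γ.typ y) → Γ.Inc x y
  typ := Γ.typ
  inc_refl x := fun _ => Γ.inc_refl x
  inc_symm h := fun r => Γ.inc_symm (h r.symm)
  eq_of_inc h e := Γ.eq_of_inc (h (e ▸ SimpleGraph.Reachable.refl _)) e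

/-- Isomorphism of pregeometries over the same type set. -/
structure Iso (Γ : Pregeometry X I) (Δ : Pregeometry Y I) extends X ≃ Y where
  typ_eq : ∀ x, Δ.typ (toFun x) = Γ.typ x
  inc_iff : ∀ x y, Δ.Inc (toFun x) (toFun y) ↔ Γ.Inc x y

/-- The direct sum property: the residue of every flag is isomorphic to the direct sum of its
truncations to the connected components of its diagram. -/
def DirectSumProperty (Γ : Pregeometry X I) : Prop :=
  ∀ F, Γ.IsFlag F → Nonempty (Iso (Γ.residue F) (Γ.residue F).sumOfComponents)

/-- The incidence graph. -/
def incGraph (Γ : Pregeometry X I) : SimpleGraph X where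
  Adj x y := x ≠ y ∧ Γ.Inc x y
  symm := ⟨fun _ _ h => ⟨h.1.symm, Γ.inc_symm h.2⟩⟩
  loopless := ⟨fun _ h => h.1 rfl⟩

/-- A pregeometry is connected if its incidence graph is connected. -/
def IsConnected (Γ : Pregeometry X I) : Prop := Γ.incGraph.Connected

/-- Elementary homotopies between paths: deleting a return or a triangle. -/
inductive ElementaryHomotopy (Γ : Pregeometry X I) {x y : X} :
    Γ.incGraph.Walk x y → Γ.incGraph.Walk x y → Prop
  | ret {a b : X} (p : Γ.incGraph.Walk x a) (h : Γ.incGraph.Adj a b) (q : Γ.incGraph.Walk a y) :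
      ElementaryHomotopy Γ (p.append (.cons h (.cons h.symm q))) (p.append q)
  | triangle {a b c : X} (p : Γ.incGraph.Walk x a) (h₁ : Γ.incGraph.Adj a b)
      (h₂ : Γ.incGraph.Adj b c) (h₃ : Γ.incGraph.Adj c a) (q : Γ.incGraph.Walk a y) :
      ElementaryHomotopy Γ (p.append (.cons h₁ (.cons h₂ (.cons h₃ q)))) (p.append q)

/-- Homotopy of paths: the equivalence relation generated by the elementary homotopies. -/
def homotopySetoid (Γ : Pregeometry X I) (x y : X) : Setoid (Γ.incGraph.Walk x y) :=
  Relation.EqvGen.setoid Γ.ElementaryHomotopy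

theorem eqvGen_map {α β : Type*} {r : α → α → Prop} {s : β → β → Prop} (f : α → β)
    (hf : ∀ a b, r a b → s (f a) (f b)) {a b : α} (h : Relation.EqvGen r a b) :
    Relation.EqvGen s (f a) (f b) := by
  induction h with
  | rel a b h => exact .rel _ _ (hf a b h)
  | refl a => exact .refl _
  | symm a b _ ih => exact .symm _ _ ih
  | trans a b c _ _ ih₁ ih₂ => exact .trans _ _ _ ih₁ ih₂

theorem ElementaryHomotopy.append_right (Γ : Pregeometry X I) {x y z : X}
    {p q : Γ.incGraph.Walk x y} (h : Γ.ElementaryHomotopy p q) (r : Γ.incGraph.Walk y z) :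
    Γ.ElementaryHomotopy (p.append r) (q.append r) := by
  cases h with
  | ret p h q =>
    simpa [← SimpleGraph.Walk.append_assoc] using ElementaryHomotopy.ret p h (q.append r)
  | triangle p h₁ h₂ h₃ q =>
    simpa [← SimpleGraph.Walk.append_assoc] using
      ElementaryHomotopy.triangle p h₁ h₂ h₃ (q.append r)

theorem ElementaryHomotopy.append_left (Γ : Pregeometry X I) {x y z : X}
    {p q : Γ.incGraph.Walk y z} (r : Γ.incGraph.Walk x y) (h : Γ.ElementaryHomotopy p q) :
    Γ.ElementaryHomotopy (r.append p) (r.append q) := by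
  cases h with
  | ret p h q =>
    simpa [SimpleGraph.Walk.append_assoc] using ElementaryHomotopy.ret (r.append p) h q
  | triangle p h₁ h₂ h₃ q =>
    simpa [SimpleGraph.Walk.append_assoc] using
      ElementaryHomotopy.triangle (r.append p) h₁ h₂ h₃ q

theorem ElementaryHomotopy.reverse (Γ : Pregeometry X I) {x y : X}
    {p q : Γ.incGraph.Walk x y} (h : Γ.ElementaryHomotopy p q) :
    Γ.ElementaryHomotopy p.reverse q.reverse := by
  cases h with
  | ret p h q =>
    have := ElementaryHomotopy.ret (Γ := Γ) q.reverse h p.reverse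
    simpa [SimpleGraph.Walk.reverse_append, SimpleGraph.Walk.reverse_cons,
      ← SimpleGraph.Walk.append_assoc] using this
  | triangle p h₁ h₂ h₃ q =>
    have := ElementaryHomotopy.triangle (Γ := Γ) q.reverse h₃.symm h₂.symm h₁.symm p.reverse
    simpa [SimpleGraph.Walk.reverse_append, SimpleGraph.Walk.reverse_cons,
      ← SimpleGraph.Walk.append_assoc] using this

theorem reverse_append_homotopic (Γ : Pregeometry X I) {x y : X} (p : Γ.incGraph.Walk x y) :
    Relation.EqvGen Γ.ElementaryHomotopy (p.reverse.append p) .nil := by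
  induction p with
  | nil => exact .refl _
  | cons h p ih =>
    refine .trans _ _ _ (.rel _ _ ?_) ih
    have := ElementaryHomotopy.ret (Γ := Γ) p.reverse h.symm p
    simpa [SimpleGraph.Walk.reverse_cons, ← SimpleGraph.Walk.append_assoc] using this

/-- The fundamental group based at `x`: closed paths at `x` modulo homotopy, under
concatenation. -/
def FundamentalGroup (Γ : Pregeometry X I) (x : X) : Type _ :=
  Quotient (Γ.homotopySetoid x x)

instance (Γ : Pregeometry X I) (x : X) : Group (Γ.FundamentalGroup x) where
  mul := Quotient.map₂ SimpleGraph.Walk.append fun _ p' hp q _ hq =>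
    Relation.EqvGen.trans _ _ _
      (eqvGen_map (fun r => r.append q) (fun _ _ h => h.append_right Γ q) hp)
      (eqvGen_map (fun r => p'.append r) (fun _ _ h => h.append_left Γ p') hq)
  one := Quotient.mk _ .nil
  inv := Quotient.map SimpleGraph.Walk.reverse fun _ _ h =>
    eqvGen_map _ (fun _ _ h => h.reverse Γ) h
  mul_assoc := by
    rintro ⟨p⟩ ⟨q⟩ ⟨r⟩
    exact congrArg (Quotient.mk _) (SimpleGraph.Walk.append_assoc p q r).symm
  one_mul := by
    rintro ⟨p⟩
    exact congrArg (Quotient.mk _) (SimpleGraph.Walk.nil_append p)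
  mul_one := by
    rintro ⟨p⟩
    exact congrArg (Quotient.mk _) (SimpleGraph.Walk.append_nil p)
  inv_mul_cancel := by
    rintro ⟨p⟩
    exact Quotient.sound (Γ.reverse_append_homotopic p)

/-- Simple connectivity: connected with trivial fundamental group. -/
def IsSimplyConnected (Γ : Pregeometry X I) : Prop :=
  Γ.IsConnected ∧ ∀ x, Subsingleton (Γ.FundamentalGroup x)

/-- A covering: a surjective homomorphism that maps the residue of every nonempty flag
isomorphically onto the residue of the image of that flag. -/
structure IsCovering (Γ' : Pregeometry Y I) (Γ : Pregeometry X I) (f : Y → X) : Prop where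
  typ_eq : ∀ y, Γ.typ (f y) = Γ'.typ y
  map_inc : ∀ y z, Γ'.Inc y z → Γ.Inc (f y) (f z)
  surjective : Function.Surjective f
  bijOn_residue : ∀ F, Γ'.IsFlag F → F.Nonempty →
    Set.BijOn f (Γ'.residueSet F) (Γ.residueSet (f '' F))
  inc_residue : ∀ F, Γ'.IsFlag F → F.Nonempty → ∀ y ∈ Γ'.residueSet F, ∀ z ∈ Γ'.residueSet F,
    (Γ.Inc (f y) (f z) ↔ Γ'.Inc y z)

/-- A universal covering: a covering that factors, uniquely once base points are chosen, through
every covering of `Γ` by a connected geometry. -/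
def IsUniversalCovering {X : Type u} {Y : Type v} {I : Type*}
    (Γ' : Pregeometry Y I) (Γ : Pregeometry X I) (f : Y → X) : Prop :=
  IsCovering Γ' Γ f ∧
    ∀ (Z : Type w) (Γ'' : Pregeometry Z I) (k : Z → X),
      Γ''.IsGeometry → Γ''.IsConnected → IsCovering Γ'' Γ k →
      ∀ (y : Y) (z : Z), f y = k z →
        ∃! r : Y → Z, IsCovering Γ' Γ'' r ∧ k ∘ r = f ∧ r y = z

/-- The group `G` acts on `Γ` by (type preserving) automorphisms. -/
def ActsByAutomorphisms (Γ : Pregeometry X I) (G : Type*) [Group G] [MulAction G X] : Prop :=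
  ∀ (h : G), (∀ x, Γ.typ (h • x) = Γ.typ x) ∧ ∀ x y, Γ.Inc (h • x) (h • y) ↔ Γ.Inc x y

/-- Transitivity on the elements of each type. -/
def IsVertexTransitive (Γ : Pregeometry X I) (G : Type*) [Group G] [MulAction G X] : Prop :=
  ∀ x y, Γ.typ x = Γ.typ y → ∃ h : G, h • x = y

/-- Transitivity on the flags of type `{i, j}`. -/
def IsFlagTransitiveOn (Γ : Pregeometry X I) (G : Type*) [Group G] [MulAction G X]
    (i j : I) : Prop :=
  ∀ x y x' y', Γ.typ x = i → Γ.typ y = j → Γ.Inc x y → Γ.typ x' = i → Γ.typ y' = j →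
    Γ.Inc x' y' → ∃ h : G, h • x = x' ∧ h • y = y'

end Pregeometry

section DiagramCoset

variable {I : Type*} {T : I → Type*} {G : Type*} [Group G]

/-- The elements of a diagram coset pregeometry: a type `i`, an index `t` in `T i` and a left
coset of the subgroup `H i t`. -/
abbrev DiagramCosetElement (H : ∀ i, T i → Subgroup G) : Type _ :=
  Σ i, Σ t : T i, G ⧸ H i t

/-- The underlying set of group elements of a coset. -/
def DiagramCosetElement.carrier {H : ∀ i, T i → Subgroup G} (a : DiagramCosetElement H) : Set G :=
  {x | (QuotientGroup.mk x : G ⧸ H a.1 a.2.1) = a.2.2}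

/-- The graph joining cosets of adjacent types that meet. -/
def diagramCosetGraph (Δ : SimpleGraph I) (H : ∀ i, T i → Subgroup G) :
    SimpleGraph (DiagramCosetElement H) where
  Adj a b := Δ.Adj a.1 b.1 ∧ (a.carrier ∩ b.carrier).Nonempty
  symm := ⟨fun _ _ h => ⟨h.1.symm, by rw [Set.inter_comm]; exact h.2⟩⟩
  loopless := ⟨fun a h => Δ.irrefl h.1⟩

/-- The diagram coset pregeometry. Cosets of the same type are incident only if they are equal
(with the same index), cosets of adjacent types are incident if they meet, and cosets of distinct
non-adjacent types `i`, `j` are incident if they are joined by a sequence of cosets,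
consecutive ones meeting, whose types form a geodesic from `i` to `j` in the diagram. -/
def diagramCosetPregeometry (Δ : SimpleGraph I) (H : ∀ i, T i → Subgroup G) :
    Pregeometry (DiagramCosetElement H) I where
  Inc a b := a = b ∨ (Δ.Adj a.1 b.1 ∧ (a.carrier ∩ b.carrier).Nonempty) ∨
    (a.1 ≠ b.1 ∧ ¬ Δ.Adj a.1 b.1 ∧
      ∃ p : (diagramCosetGraph Δ H).Walk a b, p.length = Δ.dist a.1 b.1)
  typ a := a.1
  inc_refl _ := Or.inl rfl
  inc_symm := by
    rintro a b (h | h | ⟨h₁, h₂, p, hp⟩)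
    · exact Or.inl h.symm
    · exact Or.inr (Or.inl ⟨h.1.symm, by rw [Set.inter_comm]; exact h.2⟩)
    · exact Or.inr (Or.inr ⟨h₁.symm, fun h => h₂ h.symm, p.reverse, by
        rw [SimpleGraph.Walk.length_reverse, hp, SimpleGraph.dist_comm]⟩)
  eq_of_inc := by
    rintro a b (h | h | h) e
    · exact h
    · exact absurd e h.1.ne
    · exact absurd e h.1

end DiagramCoset

/-- An amalgam of groups whose shape is a finite graded poset `J` in which every maximal chain
has an element of every one of the `n` grades (the grades are `0, …, n - 1`). -/
structure Amalgam (n : ℕ) (J : Type u) [PartialOrder J] [Finite J]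
    [GradeBoundedOrder (Fin n) J] where
  grp : J → Type v
  [group : ∀ j, Group (grp j)]
  map : ∀ {i j : J}, i < j → grp i →* grp j
  map_injective : ∀ {i j : J} (h : i < j), Function.Injective (map h)
  map_comp : ∀ {i j k : J} (h : i < j) (h' : j < k), (map h').comp (map h) = map (h.trans h')

attribute [instance] Amalgam.group

/-- An amalgam together with a fusion. -/
structure FusedAmalgam (n : ℕ) (J : Type u) [PartialOrder J] [Finite J]
    [GradeBoundedOrder (Fin n) J] extends Amalgam.{u, v} n J where
  j₀ : J
  j₁ : J
  j₂ : J
  top₀ : IsMax (grade (Fin n) j₀)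
  top₁ : IsMax (grade (Fin n) j₁)
  top₂ : IsMax (grade (Fin n) j₂)
  g : grp j₀
  i₁ : J
  i₂ : J
  cov₁₀ : i₁ ⋖ j₀
  cov₁₁ : i₁ ⋖ j₁
  cov₂₀ : i₂ ⋖ j₀
  cov₂₂ : i₂ ⋖ j₂
  γ : grp j₁ ≃* grp j₂
  /-- Conjugation by `g` maps `grp i₁` into `grp i₂` inside `grp j₀`, and agrees with `γ`. -/
  conj_eq : ∀ x : grp i₁, ∃ y : grp i₂,
    map cov₂₀.lt y = g * map cov₁₀.lt x * g⁻¹ ∧ map cov₂₂.lt y = γ (map cov₁₁.lt x)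
  fusion_eq : ∀ (i : J) (h₁ : i < j₁) (h₂ : i < j₂) (x : grp i), map h₂ x = γ (map h₁ x)

namespace FusedAmalgam

variable {n : ℕ} {J : Type u} [PartialOrder J] [Finite J] [GradeBoundedOrder (Fin n) J]

/-- The defining relators: the multiplication tables of the groups, the identifications along the
maps of the amalgam, and the fusion. -/
def relators (A : FusedAmalgam.{u, v} n J) : Set (FreeGroup (Σ j, A.grp j)) :=
  {r | ∃ (j : J) (x y : A.grp j),
      r = .of ⟨j, x⟩ * .of ⟨j, y⟩ * (.of ⟨j, x * y⟩)⁻¹} ∪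
  {r | ∃ (i j : J) (h : i < j) (x : A.grp i), r = .of ⟨i, x⟩ * (.of ⟨j, A.map h x⟩)⁻¹} ∪
  {r | ∃ x : A.grp A.j₁, r = .of ⟨A.j₂, A.γ x⟩ *
      (.of ⟨A.j₀, A.g⟩ * .of ⟨A.j₁, x⟩ * (.of ⟨A.j₀, A.g⟩)⁻¹)⁻¹}

/-- The universal enveloping group. -/
abbrev UniversalEnvelopingGroup (A : FusedAmalgam.{u, v} n J) : Type _ :=
  PresentedGroup A.relators

/-- The canonical homomorphism from a member of the amalgam to the universal enveloping group. -/
def toUniversal (A : FusedAmalgam.{u, v} n J) (j : J) : A.grp j →* A.UniversalEnvelopingGroup :=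
  MonoidHom.mk' (fun x => PresentedGroup.of ⟨j, x⟩) fun x y => by
    have h : (PresentedGroup.mk A.relators)
        (.of ⟨j, x⟩ * .of ⟨j, y⟩ * (.of ⟨j, x * y⟩)⁻¹) = 1 :=
      PresentedGroup.one_of_mem (Or.inl (Or.inl ⟨j, x, y, rfl⟩))
    rw [map_mul, map_mul, map_inv, mul_inv_eq_one] at h
    exact h.symm

/-- A family of homomorphisms from the members of the amalgam to a group `H` that is compatible
with the maps of the amalgam and preserves the fusion. -/
structure CompatibleFamily (A : FusedAmalgam.{u, v} n J) (H : Type*) [Group H] where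
  hom : ∀ j, A.grp j →* H
  hom_map : ∀ {i j : J} (h : i < j) (x : A.grp i), hom j (A.map h x) = hom i x
  hom_fusion : ∀ x : A.grp A.j₁,
    hom A.j₂ (A.γ x) = hom A.j₀ A.g * hom A.j₁ x * (hom A.j₀ A.g)⁻¹

/-- The homomorphism from the universal enveloping group that a compatible family induces. -/
def CompatibleFamily.lift {A : FusedAmalgam.{u, v} n J} {H : Type*} [Group H]
    (E : A.CompatibleFamily H) : A.UniversalEnvelopingGroup →* H :=
  PresentedGroup.toGroup (f := fun s : Σ j, A.grp j => E.hom s.1 s.2) (by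
    rintro r ((⟨j, x, y, rfl⟩ | ⟨i, j, h, x, rfl⟩) | ⟨x, rfl⟩)
    · simp
    · simp [E.hom_map]
    · simp [E.hom_fusion])

theorem CompatibleFamily.lift_toUniversal {A : FusedAmalgam.{u, v} n J} {H : Type*} [Group H]
    (E : A.CompatibleFamily H) (j : J) (x : A.grp j) :
    E.lift (A.toUniversal j x) = E.hom j x :=
  PresentedGroup.toGroup.of _

end FusedAmalgam

section Parabolics

/-- The shape of the amalgam of parabolics. The numbers `0, 1, 2, 3` stand for a point, a line and
two planes, and the members of the poset are the nonempty sets of them that do not contain both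
planes, ordered by reverse inclusion. -/
abbrev ParabolicIndex : Type :=
  {S : Finset (Fin 4) // S.Nonempty ∧ ¬ (2 ∈ S ∧ 3 ∈ S)}ᵒᵈ

/-- The set of numbers that an index stands for. -/
def ParabolicIndex.toFinset (S : ParabolicIndex) : Finset (Fin 4) := (OrderDual.ofDual S).1

/-- The index of a vertex stabiliser. -/
def ParabolicIndex.single (i : Fin 4) : ParabolicIndex :=
  OrderDual.toDual ⟨{i}, by simp, by revert i; decide⟩

/-- The index of the stabiliser of a line and a plane. -/
def ParabolicIndex.linePlane₁ : ParabolicIndex := OrderDual.toDual ⟨{1, 2}, by decide⟩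

/-- The index of the stabiliser of the line and the second plane. -/
def ParabolicIndex.linePlane₂ : ParabolicIndex := OrderDual.toDual ⟨{1, 3}, by decide⟩

/-- Sets with three, two, one members have grade `0`, `1`, `2`. -/
instance : GradeBoundedOrder (Fin 3) ParabolicIndex where
  grade S := Fin.ofNat 3 (3 - S.toFinset.card)
  grade_strictMono := by
    have : ∀ S T : ParabolicIndex, S < T →
      Fin.ofNat 3 (3 - S.toFinset.card) < Fin.ofNat 3 (3 - T.toFinset.card) := by decide
    exact fun S T h => this S T h
  covBy_grade := by
    have : ∀ S T : ParabolicIndex, (S < T ∧ ∀ U, S < U → ¬ U < T) →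
      (Fin.ofNat 3 (3 - S.toFinset.card) < Fin.ofNat 3 (3 - T.toFinset.card) ∧
        ∀ k, Fin.ofNat 3 (3 - S.toFinset.card) < k →
          ¬ k < Fin.ofNat 3 (3 - T.toFinset.card)) := by decide
    exact fun {S T} h => ⟨(this S T ⟨h.1, fun U => @h.2 U⟩).1,
      fun k => (this S T ⟨h.1, fun U => @h.2 U⟩).2 k⟩
  isMin_grade := by
    have : ∀ S : ParabolicIndex, (∀ T, T ≤ S → S ≤ T) →
      ∀ k, k ≤ Fin.ofNat 3 (3 - S.toFinset.card) → Fin.ofNat 3 (3 - S.toFinset.card) ≤ k := by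
      decide
    exact fun S h k => this S (fun T => @h T) k
  isMax_grade := by
    have : ∀ S : ParabolicIndex, (∀ T, S ≤ T → T ≤ S) →
      ∀ k, Fin.ofNat 3 (3 - S.toFinset.card) ≤ k → k ≤ Fin.ofNat 3 (3 - S.toFinset.card) := by
      decide
    exact fun S h k => this S (fun T => @h T) k

theorem ParabolicIndex.covBy_of {S T : ParabolicIndex}
    (h : S < T ∧ ∀ U, S < U → ¬ U < T) : S ⋖ T :=
  ⟨h.1, fun U => h.2 U⟩

variable {X : Type u} {G : Type v} [Group G] [MulAction G X]

/-- The elements that the numbers `0, 1, 2, 3` stand for: `w 0`, `w 1`, `w 2` and `g • w 2`. -/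
def parabolicElement (w : Fin 3 → X) (g : G) : Fin 4 → X :=
  ![w 0, w 1, w 2, g • w 2]

/-- The parabolic: the pointwise stabiliser in `G` of the elements that `S` stands for. -/
def parabolic (w : Fin 3 → X) (g : G) (S : ParabolicIndex) : Subgroup G :=
  fixingSubgroup G (parabolicElement w g '' S.toFinset)

theorem mem_parabolic {w : Fin 3 → X} {g : G} {S : ParabolicIndex} {h : G} :
    h ∈ parabolic w g S ↔
      ∀ i ∈ S.toFinset, h • parabolicElement w g i = parabolicElement w g i := by
  simp [parabolic, mem_fixingSubgroup_iff]

theorem parabolic_mono (w : Fin 3 → X) (g : G) {S T : ParabolicIndex} (h : S ≤ T) :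
    parabolic w g S ≤ parabolic w g T := fun _ hx =>
  mem_parabolic.2 fun i hi => mem_parabolic.1 hx i (h hi)

theorem conj_mem_parabolic_iff (w : Fin 3 → X) (g x : G) :
    g * x * g⁻¹ ∈ parabolic w g (.single 3) ↔ x ∈ parabolic w g (.single 2) := by
  simp [mem_parabolic, ParabolicIndex.single, ParabolicIndex.toFinset, parabolicElement, mul_smul]

/-- The fused amalgam of parabolics of `w 0`, `w 1`, `w 2` and `g • w 2`, where `g` stabilises
`w 1`: the maps are the inclusions, and the fusion is conjugation by `g` from the stabiliser of
`w 2` to the stabiliser of `g • w 2`. -/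
def fusedAmalgamOfParabolics (w : Fin 3 → X) (g : G) (hg : g • w 1 = w 1) :
    FusedAmalgam.{0, v} 3 ParabolicIndex where
  grp S := parabolic w g S
  map h := Subgroup.inclusion (parabolic_mono w g h.le)
  map_injective h := Subgroup.inclusion_injective _
  map_comp _ _ := rfl
  j₀ := .single 1
  j₁ := .single 2
  j₂ := .single 3
  top₀ := fun k _ => by revert k; decide
  top₁ := fun k _ => by revert k; decide
  top₂ := fun k _ => by revert k; decide
  g := ⟨g, by
    simp [mem_parabolic, ParabolicIndex.single, ParabolicIndex.toFinset, parabolicElement, hg]⟩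
  i₁ := .linePlane₁
  i₂ := .linePlane₂
  cov₁₀ := ParabolicIndex.covBy_of (by decide)
  cov₁₁ := ParabolicIndex.covBy_of (by decide)
  cov₂₀ := ParabolicIndex.covBy_of (by decide)
  cov₂₂ := ParabolicIndex.covBy_of (by decide)
  γ :=
    { toFun := fun x => ⟨g * x * g⁻¹, (conj_mem_parabolic_iff w g x).2 x.2⟩
      invFun := fun y => ⟨g⁻¹ * y * g, (conj_mem_parabolic_iff w g _).1 (by
        simp [mul_assoc])⟩
      left_inv := fun x => Subtype.ext (by simp [mul_assoc])
      right_inv := fun y => Subtype.ext (by simp [mul_assoc])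
      map_mul' := fun x y => Subtype.ext (by simp [mul_assoc]) }
  conj_eq := fun x => by
    have hg' : g⁻¹ • w 1 = w 1 := inv_smul_eq_iff.2 hg.symm
    refine ⟨⟨g * x * g⁻¹, ?_⟩, rfl, rfl⟩
    have hx := mem_parabolic.1 x.2
    simp only [ParabolicIndex.linePlane₁, ParabolicIndex.toFinset, OrderDual.ofDual_toDual,
      Finset.mem_insert, Finset.mem_singleton, forall_eq_or_imp, forall_eq,
      parabolicElement] at hx
    refine mem_parabolic.2 ?_
    simp only [ParabolicIndex.linePlane₂, ParabolicIndex.toFinset, OrderDual.ofDual_toDual,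
      Finset.mem_insert, Finset.mem_singleton, forall_eq_or_imp, forall_eq, parabolicElement]
    refine ⟨?_, ?_⟩
    · have h1 : (x : G) • w 1 = w 1 := hx.1
      change (g * x * g⁻¹) • w 1 = w 1
      rw [mul_smul, mul_smul, hg', h1, hg]
    · have h2 : (x : G) • w 2 = w 2 := hx.2
      change (g * x * g⁻¹) • g • w 2 = g • w 2
      rw [mul_smul, mul_smul, inv_smul_smul, h2]
  fusion_eq := fun i h₁ h₂ => by
    have key : ∀ i : ParabolicIndex, i < .single 2 → ¬ i < .single 3 := by decide
    exact absurd h₂ (key i h₁)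

/-- The inclusions of the parabolics in `G`. -/
def parabolicFamily (w : Fin 3 → X) (g : G) (hg : g • w 1 = w 1) :
    (fusedAmalgamOfParabolics w g hg).CompatibleFamily G where
  hom S := (parabolic w g S).subtype
  hom_map _ _ := rfl
  hom_fusion _ := rfl

/-- The images in the universal enveloping group of the stabilisers of `w 0`, `w 1`, `w 2`. -/
def vertexSubgroup (w : Fin 3 → X) (g : G) (hg : g • w 1 = w 1) (i : Fin 3) (_ : Unit) :
    Subgroup (fusedAmalgamOfParabolics w g hg).UniversalEnvelopingGroup :=
  ((fusedAmalgamOfParabolics w g hg).toUniversal (.single i.castSucc)).range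

/-- The diagram coset pregeometry of the universal enveloping group of the fused amalgam of
parabolics with respect to the stabilisers of `w 0`, `w 1`, `w 2`, over the path diagram. -/
def universalCosetPregeometry (w : Fin 3 → X) (g : G) (hg : g • w 1 = w 1) :
    Pregeometry (DiagramCosetElement (vertexSubgroup w g hg)) (Fin 3) :=
  diagramCosetPregeometry (SimpleGraph.pathGraph 3) (vertexSubgroup w g hg)

/-- The natural homomorphism from the universal enveloping group to `G`. -/
def naturalHom (w : Fin 3 → X) (g : G) (hg : g • w 1 = w 1) :
    (fusedAmalgamOfParabolics w g hg).UniversalEnvelopingGroup →* G :=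
  (parabolicFamily w g hg).lift

end Parabolics

/-!
Write `U` for the universal enveloping group of the fused amalgam, `ψ : U → G` for the natural
homomorphism, and `Γ̂` for the coset pregeometry of `U`. Two facts carry the proof: `uGᵢ ↦ ψ(u)
wᵢ` is a covering, and `Γ̂` is simply connected. The rest is covering theory for incidence
graphs.

*The map is a covering* (`cosetMap_isCovering`). It suffices to look at the elements incident
with a single element: they can be lifted, and incidence between them is reflected
(`Pregeometry.isCovering_of_lift`). Lifting is flag-transitivity, since an incident pair of types
`0` and `2` can be joined through type `1`. As residues of elements of type `1` are generalised
digons, reflecting incidence comes down to injectivity on the elements incident with a given one.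
The members of the amalgam belonging to flags of two elements give it for adjacent types
(`mem_stabilizerImage_iff`). For the types `0` and `2` the orbit hypothesis provides a normal
form, `(u w₀, u w₂)` or `(u w₀, u g w₂)`, for incident pairs
(`exists_of_universalCoset_inc_zero_two`). The two forms have different images because the two
orbits are different, and in the second form the stabiliser of `w₀` and `g w₂` takes the place of
that of `w₀` and `w₂`, which is where the fusion is needed (`cosetElement_zero_eq_iff_two_eq`).

*The coset pregeometry is simply connected* (`universalCoset_isSimplyConnected`). No cover of
`Γ̂` is constructed. Let `K` be the edge group of `Γ̂`, generated by the pairs `e(a, b)` subject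
to `e(a, b) e(b, c) = e(a, c)` for pairwise incident elements. A closed walk whose edges have
product `1` in `K` is null-homotopic (`Pregeometry.homotopic_nil_of_holonomy_eq_one`), and `U`
acts on `K`. In `K ⋊ U`, let the stabiliser of each of the four base cosets `ŵ` be conjugated by
`e(ŵ₁, ŵ)`. On a flag of base cosets these conjugations agree, because the edges of the flag are
fixed by its stabiliser; they respect the fusion because `g` fixes `ŵ₁`. So the universal
property of `U` extends them to a homomorphism `Φ : U → K ⋊ U`, and `uŵᵢ ↦ Φ(u) e(ŵ₁, ŵᵢ) u⁻¹` is
a potential for the edges: it shows that the edges of every closed walk have product `1` in `K`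
(`pathCoset_isSimplyConnected`).

*Conclusion.* A simply connected covering is universal
(`Pregeometry.IsCovering.isUniversalCovering`). The kernel of `ψ` acts regularly on the fibres of
the covering, hence is the fundamental group of `Γ`
(`Pregeometry.IsCovering.exists_groupExtension`).
-/

namespace Pregeometry

variable {X Y Z I : Type*}

/-! ### Homotopy of walks -/

/-- Homotopy of walks with the same end points. -/
abbrev Homotopic (Γ : Pregeometry X I) {x y : X} (p q : Γ.incGraph.Walk x y) : Prop :=
  Relation.EqvGen Γ.ElementaryHomotopy p q

theorem Homotopic.append_left {Γ : Pregeometry X I} {x y z : X} (r : Γ.incGraph.Walk x y)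
    {p q : Γ.incGraph.Walk y z} (h : Γ.Homotopic p q) :
    Γ.Homotopic (r.append p) (r.append q) :=
  eqvGen_map (fun p => r.append p) (fun _ _ h => h.append_left Γ r) h

theorem Homotopic.append_right {Γ : Pregeometry X I} {x y z : X} {p q : Γ.incGraph.Walk x y}
    (h : Γ.Homotopic p q) (r : Γ.incGraph.Walk y z) :
    Γ.Homotopic (p.append r) (q.append r) :=
  eqvGen_map (fun p => p.append r) (fun _ _ h => h.append_right Γ r) h

/-- A walk followed by its reverse can be deleted. -/
theorem homotopic_cancel (Γ : Pregeometry X I) {x a b y : X} (p : Γ.incGraph.Walk x a)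
    (r : Γ.incGraph.Walk b a) (q : Γ.incGraph.Walk a y) :
    Γ.Homotopic (p.append (r.reverse.append (r.append q))) (p.append q) := by
  have h := Homotopic.append_right (Γ.reverse_append_homotopic r) q
  rw [← SimpleGraph.Walk.append_assoc] at h
  exact h.append_left p

/-- Two sides of a triangle can be replaced by the third one. -/
theorem homotopic_triangle (Γ : Pregeometry X I) {x a b c y : X} (p : Γ.incGraph.Walk x a)
    (hab : Γ.incGraph.Adj a b) (hbc : Γ.incGraph.Adj b c) (hac : Γ.incGraph.Adj a c)
    (q : Γ.incGraph.Walk c y) :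
    Γ.Homotopic (p.append (.cons hab (.cons hbc q))) (p.append (.cons hac q)) := by
  refine .trans _ _ _ (.symm _ _ (.rel _ _ ?_))
    (.rel _ _ (.triangle p hab hbc hac.symm (.cons hac q)))
  simpa [← SimpleGraph.Walk.append_assoc] using
    ElementaryHomotopy.ret (Γ := Γ) (p.append (.cons hab (.cons hbc .nil))) hac.symm q

/-- The class of a closed walk in the fundamental group. -/
def loopClass (Γ : Pregeometry X I) {x : X} (p : Γ.incGraph.Walk x x) : Γ.FundamentalGroup x :=
  Quotient.mk (Γ.homotopySetoid x x) p

theorem loopClass_eq_iff (Γ : Pregeometry X I) {x : X} {p q : Γ.incGraph.Walk x x} :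
    Γ.loopClass p = Γ.loopClass q ↔ Γ.Homotopic p q :=
  Quotient.eq (r := Γ.homotopySetoid x x)

theorem loopClass_surjective (Γ : Pregeometry X I) (x : X) :
    Function.Surjective (Γ.loopClass (x := x)) :=
  Quotient.mk_surjective

@[simp]
theorem loopClass_nil (Γ : Pregeometry X I) (x : X) :
    Γ.loopClass (.nil : Γ.incGraph.Walk x x) = 1 := rfl

theorem loopClass_append (Γ : Pregeometry X I) {x : X} (p q : Γ.incGraph.Walk x x) :
    Γ.loopClass (p.append q) = Γ.loopClass p * Γ.loopClass q := rfl

theorem loopClass_reverse (Γ : Pregeometry X I) {x : X} (p : Γ.incGraph.Walk x x) :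
    Γ.loopClass p.reverse = (Γ.loopClass p)⁻¹ := rfl

theorem isSimplyConnected_iff (Γ : Pregeometry X I) :
    Γ.IsSimplyConnected ↔
      Γ.IsConnected ∧ ∀ (x : X) (p : Γ.incGraph.Walk x x), Γ.Homotopic p .nil := by
  refine and_congr_right fun _ => forall_congr' fun x => ⟨fun h p => ?_, fun h => ⟨?_⟩⟩
  · exact Γ.loopClass_eq_iff.1 (h.elim _ _)
  · intro a b
    obtain ⟨p, rfl⟩ := Γ.loopClass_surjective x a
    obtain ⟨q, rfl⟩ := Γ.loopClass_surjective x b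
    exact Γ.loopClass_eq_iff.2 (.trans _ _ _ (h p) (.symm _ _ (h q)))

/-- In a simply connected pregeometry any two walks with the same end points are homotopic. -/
theorem IsSimplyConnected.homotopic {Γ : Pregeometry X I} (h : Γ.IsSimplyConnected) {x y : X}
    (p q : Γ.incGraph.Walk x y) : Γ.Homotopic p q := by
  have h₁ := Homotopic.append_right ((Γ.isSimplyConnected_iff.1 h).2 x (p.append q.reverse)) q
  have h₂ := Γ.homotopic_cancel p q .nil
  have h₃ : Γ.Homotopic ((p.append q.reverse).append q) p := by
    simpa [← SimpleGraph.Walk.append_assoc] using h₂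
  exact .trans _ _ _ (.symm _ _ h₃) (by simpa using h₁)

/-! ### The edge group -/

/-- The relators of the edge group, one for each triple of pairwise incident elements. -/
def edgeRelators (Γ : Pregeometry X I) : Set (FreeGroup (X × X)) :=
  {r | ∃ a b c, Γ.Inc a b ∧ Γ.Inc b c ∧ Γ.Inc a c ∧
    r = .of (a, b) * .of (b, c) * (.of (a, c))⁻¹}

/-- The edge group: the group generated by the pairs of elements, subject to
`(a, b) (b, c) = (a, c)` whenever `a`, `b`, `c` are pairwise incident. It receives the fundamental
groups at all base points, and every group of automorphisms acts on it, without a choice of a base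
point. The pairs of elements that are not incident generate a free factor, which plays no role. -/
abbrev EdgeGroup (Γ : Pregeometry X I) : Type _ := PresentedGroup Γ.edgeRelators

/-- The generator of the edge group given by a pair of elements. -/
def edge (Γ : Pregeometry X I) (a b : X) : Γ.EdgeGroup := PresentedGroup.of (a, b)

theorem edge_mul_edge (Γ : Pregeometry X I) {a b c : X} (hab : Γ.Inc a b) (hbc : Γ.Inc b c)
    (hac : Γ.Inc a c) : Γ.edge a b * Γ.edge b c = Γ.edge a c := by
  have h : (PresentedGroup.mk Γ.edgeRelators) (.of (a, b) * .of (b, c) * (.of (a, c))⁻¹) = 1 :=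
    PresentedGroup.one_of_mem ⟨a, b, c, hab, hbc, hac, rfl⟩
  rw [map_mul, map_mul, map_inv, mul_inv_eq_one] at h
  exact h

@[simp]
theorem edge_self (Γ : Pregeometry X I) (a : X) : Γ.edge a a = 1 := by
  simpa using Γ.edge_mul_edge (Γ.inc_refl a) (Γ.inc_refl a) (Γ.inc_refl a)

/-- The product in the edge group of the edges of a walk. -/
def holonomy (Γ : Pregeometry X I) {x y : X} : Γ.incGraph.Walk x y → Γ.EdgeGroup
  | .nil => 1
  | .cons (u := a) (v := b) _ p => Γ.edge a b * Γ.holonomy p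

open Classical in
/-- The closed walk at `x` that runs to `a` along `t a`, then along the edge from `a` to `b`, and
back along `t b`. -/
noncomputable def edgeLoop (Γ : Pregeometry X I) {x : X} (t : ∀ a, Γ.incGraph.Walk x a) (a b : X) :
    Γ.FundamentalGroup x :=
  if h : Γ.incGraph.Adj a b then Γ.loopClass ((t a).append (.cons h (t b).reverse)) else 1

theorem edgeLoop_self (Γ : Pregeometry X I) {x : X} (t : ∀ a, Γ.incGraph.Walk x a) (a : X) :
    Γ.edgeLoop t a a = 1 := by
  simp [edgeLoop]

theorem edgeLoop_mul (Γ : Pregeometry X I) {x : X} (t : ∀ a, Γ.incGraph.Walk x a) {a b c : X}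
    (hab : Γ.Inc a b) (hbc : Γ.Inc b c) (hac : Γ.Inc a c) :
    Γ.edgeLoop t a b * Γ.edgeLoop t b c = Γ.edgeLoop t a c := by
  by_cases h₁ : a = b
  · subst h₁; simp [edgeLoop_self]
  by_cases h₂ : b = c
  · subst h₂; simp [edgeLoop_self]
  have hab' : Γ.incGraph.Adj a b := ⟨h₁, hab⟩
  have hbc' : Γ.incGraph.Adj b c := ⟨h₂, hbc⟩
  have key : Γ.Homotopic
      (((t a).append (.cons hab' (t b).reverse)).append ((t b).append (.cons hbc' (t c).reverse)))
      ((t a).append (.cons hab' (.cons hbc' (t c).reverse))) := by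
    simpa [← SimpleGraph.Walk.append_assoc] using Γ.homotopic_cancel
      ((t a).append (.cons hab' .nil)) (t b) (.cons hbc' (t c).reverse)
  by_cases h₃ : a = c
  · subst h₃
    rw [edgeLoop_self, edgeLoop, edgeLoop, dif_pos hab', dif_pos hbc', ← loopClass_append,
      ← loopClass_nil]
    refine Γ.loopClass_eq_iff.2 (.trans _ _ _ key ?_)
    refine .trans _ _ _ (.rel _ _ (.ret _ hab' _)) ?_
    simpa using Γ.reverse_append_homotopic (t a).reverse
  · have hac' : Γ.incGraph.Adj a c := ⟨h₃, hac⟩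
    rw [edgeLoop, edgeLoop, edgeLoop, dif_pos hab', dif_pos hbc', dif_pos hac',
      ← loopClass_append]
    exact Γ.loopClass_eq_iff.2
      (.trans _ _ _ key (Γ.homotopic_triangle _ hab' hbc' hac' _))

/-- The homomorphism from the edge group to the fundamental group at `x` given by a choice of walks
from `x` to all elements. -/
noncomputable def edgeGroupToFundamentalGroup (Γ : Pregeometry X I) {x : X}
    (t : ∀ a, Γ.incGraph.Walk x a) : Γ.EdgeGroup →* Γ.FundamentalGroup x :=
  PresentedGroup.toGroup (f := fun s : X × X => Γ.edgeLoop t s.1 s.2) (by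
    rintro r ⟨a, b, c, hab, hbc, hac, rfl⟩
    simp [Γ.edgeLoop_mul t hab hbc hac])

theorem edgeGroupToFundamentalGroup_edge (Γ : Pregeometry X I) {x : X}
    (t : ∀ a, Γ.incGraph.Walk x a) (a b : X) :
    Γ.edgeGroupToFundamentalGroup t (Γ.edge a b) = Γ.edgeLoop t a b :=
  PresentedGroup.toGroup.of _

theorem edgeGroupToFundamentalGroup_holonomy (Γ : Pregeometry X I) {x : X}
    (t : ∀ a, Γ.incGraph.Walk x a) {a b : X} (p : Γ.incGraph.Walk a b) :
    Γ.edgeGroupToFundamentalGroup t (Γ.holonomy p) =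
      Γ.loopClass ((t a).append (p.append (t b).reverse)) := by
  induction p with
  | nil =>
    refine (map_one _).trans (Γ.loopClass_eq_iff.2 (.symm _ _ ?_))
    simpa using Γ.reverse_append_homotopic (t _).reverse
  | @cons a c b h p ih =>
    rw [holonomy, map_mul, ih, edgeGroupToFundamentalGroup_edge, edgeLoop, dif_pos h,
      ← loopClass_append]
    refine Γ.loopClass_eq_iff.2 ?_
    have := Γ.homotopic_cancel ((t a).append (.cons h .nil)) (t c) (p.append (t b).reverse)
    simpa [← SimpleGraph.Walk.append_assoc] using this

/-- The edge group detects homotopy: it contains the fundamental group. -/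
theorem homotopic_nil_of_holonomy_eq_one {Γ : Pregeometry X I} (hconn : Γ.IsConnected) {x : X}
    {p : Γ.incGraph.Walk x x} (hp : Γ.holonomy p = 1) : Γ.Homotopic p .nil := by
  let t : ∀ a, Γ.incGraph.Walk x a := fun a => (hconn.preconnected x a).some
  have h := Γ.edgeGroupToFundamentalGroup_holonomy t p
  rw [hp, map_one, loopClass_append, loopClass_append, loopClass_reverse, eq_comm, ← mul_assoc,
    mul_inv_eq_one, mul_eq_left, ← loopClass_nil] at h
  exact Γ.loopClass_eq_iff.1 h

/-- A connected pregeometry is simply connected if its edges, as elements of the edge group or of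
a larger group, have a potential. -/
theorem isSimplyConnected_of_potential {Γ : Pregeometry X I} (hconn : Γ.IsConnected) {P : Type*}
    [Group P] (ι : Γ.EdgeGroup →* P) (hι : Function.Injective ι) (c : X → P)
    (hc : ∀ a b, Γ.Inc a b → c a * ι (Γ.edge a b) = c b) : Γ.IsSimplyConnected := by
  have key : ∀ {a b : X} (p : Γ.incGraph.Walk a b), c a * ι (Γ.holonomy p) = c b := by
    intro a b p
    induction p with
    | nil => simp [holonomy]
    | cons h p ih => rw [holonomy, map_mul, ← mul_assoc, hc _ _ h.2, ih]
  refine Γ.isSimplyConnected_iff.2 ⟨hconn, fun x p => homotopic_nil_of_holonomy_eq_one hconn ?_⟩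
  exact (map_eq_one_iff ι hι).1 (mul_eq_left.1 (key p))

section EdgeAction

variable {U : Type*} [Group U] [MulAction U X]

/-- The endomorphism of the edge group induced by an automorphism of the pregeometry. -/
def edgeMap {Γ : Pregeometry X I} (haut : Γ.ActsByAutomorphisms U) (h : U) :
    Γ.EdgeGroup →* Γ.EdgeGroup :=
  PresentedGroup.toGroup (f := fun s : X × X => Γ.edge (h • s.1) (h • s.2)) (by
    rintro r ⟨a, b, c, hab, hbc, hac, rfl⟩
    simp [Γ.edge_mul_edge (((haut h).2 a b).2 hab) (((haut h).2 b c).2 hbc)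
      (((haut h).2 a c).2 hac)])

theorem edgeMap_edge {Γ : Pregeometry X I} (haut : Γ.ActsByAutomorphisms U) (h : U) (a b : X) :
    edgeMap haut h (Γ.edge a b) = Γ.edge (h • a) (h • b) :=
  PresentedGroup.toGroup.of _

/-- The action on the edge group of a group of automorphisms of the pregeometry. -/
def edgeAction {Γ : Pregeometry X I} (haut : Γ.ActsByAutomorphisms U) :
    U →* MulAut Γ.EdgeGroup :=
  letI : MulDistribMulAction U Γ.EdgeGroup :=
    { smul := fun h k => edgeMap haut h k
      one_smul := DFunLike.congr_fun (f := edgeMap haut 1) (g := MonoidHom.id _)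
        (PresentedGroup.ext fun s => by
          refine (edgeMap_edge haut 1 s.1 s.2).trans ?_
          simp only [one_smul]
          rfl)
      mul_smul := fun h h' => DFunLike.congr_fun
        (f := edgeMap haut (h * h')) (g := (edgeMap haut h).comp (edgeMap haut h'))
        (PresentedGroup.ext fun s => by
          refine (edgeMap_edge haut (h * h') s.1 s.2).trans ?_
          rw [mul_smul, mul_smul, ← edgeMap_edge haut, ← edgeMap_edge haut]
          rfl)
      smul_mul := fun h => map_mul (edgeMap haut h)
      smul_one := fun h => map_one (edgeMap haut h) }
  MulDistribMulAction.toMulAut U Γ.EdgeGroup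

theorem edgeAction_edge {Γ : Pregeometry X I} (haut : Γ.ActsByAutomorphisms U) (h : U) (a b : X) :
    edgeAction haut h (Γ.edge a b) = Γ.edge (h • a) (h • b) :=
  edgeMap_edge haut h a b

end EdgeAction

/-! ### Coverings -/

section Covering

variable {Γ : Pregeometry X I} {Γ' : Pregeometry Y I} {Γ'' : Pregeometry Z I} {f : Y → X}
  {k : Z → X}

theorem IsCovering.exists_lift (hf : IsCovering Γ' Γ f) {a : Y} {x : X} (h : Γ.Inc (f a) x) :
    ∃ b, Γ'.Inc a b ∧ f b = x := by
  by_cases hx : x = f a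
  · exact ⟨a, Γ'.inc_refl a, hx.symm⟩
  · have hF : Γ'.IsFlag {a} := by rintro _ rfl _ rfl; exact Γ'.inc_refl _
    obtain ⟨b, hb, rfl⟩ := (hf.bijOn_residue {a} hF ⟨a, rfl⟩).surjOn
      (show x ∈ Γ.residueSet (f '' {a}) by
        rw [Set.image_singleton]
        exact ⟨hx, by rintro _ rfl; exact Γ.inc_symm h⟩)
    exact ⟨b, Γ'.inc_symm (hb.2 a rfl), rfl⟩

theorem IsCovering.inc_of_inc (hf : IsCovering Γ' Γ f) {a b c : Y} (hab : Γ'.Inc a b)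
    (hac : Γ'.Inc a c) (h : Γ.Inc (f b) (f c)) : Γ'.Inc b c := by
  have hF : Γ'.IsFlag {a} := by rintro _ rfl _ rfl; exact Γ'.inc_refl _
  have key : ∀ {d}, Γ'.Inc a d → d ≠ a → d ∈ Γ'.residueSet {a} := fun hd hne =>
    ⟨hne, by rintro _ rfl; exact Γ'.inc_symm hd⟩
  by_cases hb : b = a
  · exact hb ▸ hac
  by_cases hc : c = a
  · exact hc ▸ Γ'.inc_symm hab
  exact (hf.inc_residue {a} hF ⟨a, rfl⟩ b (key hab hb) c (key hac hc)).1 h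

/-- A covering is injective on the elements incident with a given one. -/
theorem IsCovering.eq_of_inc (hf : IsCovering Γ' Γ f) {a b c : Y} (hab : Γ'.Inc a b)
    (hac : Γ'.Inc a c) (h : f b = f c) : b = c :=
  Γ'.eq_of_inc (hf.inc_of_inc hab hac (h ▸ Γ.inc_refl _)) (by rw [← hf.typ_eq, ← hf.typ_eq, h])

/-- To be a covering can be checked on the elements incident with a single element: they have to
be lifted, and incidence between them has to be reflected. -/
theorem isCovering_of_lift (htyp : ∀ a, Γ.typ (f a) = Γ'.typ a)
    (hinc : ∀ a b, Γ'.Inc a b → Γ.Inc (f a) (f b)) (hsurj : Function.Surjective f)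
    (hlift : ∀ a x, Γ.Inc (f a) x → ∃ b, Γ'.Inc a b ∧ f b = x)
    (hrefl : ∀ a b c, Γ'.Inc a b → Γ'.Inc a c → Γ.Inc (f b) (f c) → Γ'.Inc b c) :
    IsCovering Γ' Γ f := by
  have hinj : ∀ a b c, Γ'.Inc a b → Γ'.Inc a c → f b = f c → b = c := fun a b c hab hac h =>
    Γ'.eq_of_inc (hrefl a b c hab hac (h ▸ Γ.inc_refl _)) (by rw [← htyp, ← htyp, h])
  refine ⟨htyp, hinc, hsurj, fun F hF hne => ⟨?_, ?_, ?_⟩, fun F hF hne b hb c hc =>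
    ⟨?_, hinc b c⟩⟩ <;> obtain ⟨a, ha⟩ := hne
  · intro b hb
    refine ⟨?_, ?_⟩
    · rintro ⟨c, hc, h⟩
      exact hb.1 (hinj a c b (hF a ha c hc) (Γ'.inc_symm (hb.2 a ha)) h ▸ hc)
    · rintro _ ⟨c, hc, rfl⟩
      exact hinc _ _ (hb.2 c hc)
  · exact fun b hb c hc h => hinj a b c (Γ'.inc_symm (hb.2 a ha)) (Γ'.inc_symm (hc.2 a ha)) h
  · intro x hx
    obtain ⟨b, hab, rfl⟩ := hlift a x (Γ.inc_symm (hx.2 _ ⟨a, ha, rfl⟩))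
    exact ⟨b, ⟨fun hb => hx.1 ⟨b, hb, rfl⟩,
      fun c hc => hrefl a b c hab (hF a ha c hc) (hx.2 _ ⟨c, hc, rfl⟩)⟩, rfl⟩
  · exact fun h => hrefl a b c (Γ'.inc_symm (hb.2 a ha)) (Γ'.inc_symm (hc.2 a ha)) h

/-- A map that lifts incident elements is onto every connected pregeometry. -/
theorem surjective_of_lift [Nonempty Y] (hconn : Γ.IsConnected)
    (hlift : ∀ a x, Γ.Inc (f a) x → ∃ b, Γ'.Inc a b ∧ f b = x) : Function.Surjective f := by
  have key : ∀ {x y : X} (_ : Γ.incGraph.Walk x y), x ∈ Set.range f → y ∈ Set.range f := by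
    intro x y p
    induction p with
    | nil => exact id
    | cons h p ih =>
      rintro ⟨a, rfl⟩
      obtain ⟨b, -, rfl⟩ := hlift a _ h.2
      exact ih ⟨b, rfl⟩
  exact fun x => key (hconn.preconnected (f (Classical.arbitrary Y)) x).some ⟨_, rfl⟩

/-- Chambers lift through coverings, so that coverings of geometries are geometries. -/
theorem IsCovering.isGeometry [Nonempty Y] (hf : IsCovering Γ' Γ f) (hΓ : Γ.IsGeometry) :
    Γ'.IsGeometry := by
  have key : ∀ F, Γ'.IsFlag F → F.Nonempty → ∃ C, Γ'.IsChamber C ∧ F ⊆ C := by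
    rintro F hF ⟨a, ha⟩
    obtain ⟨C, hC, hFC⟩ := hΓ (f '' F) (by
      rintro _ ⟨b, hb, rfl⟩ _ ⟨c, hc, rfl⟩
      exact hf.map_inc _ _ (hF b hb c hc))
    refine ⟨{b | Γ'.Inc a b ∧ f b ∈ C}, ⟨fun b hb c hc => ?_, ?_⟩,
      fun b hb => ⟨hF a ha b hb, hFC ⟨b, hb, rfl⟩⟩⟩
    · exact hf.inc_of_inc hb.1 hc.1 (hC.1 _ hb.2 _ hc.2)
    · refine Set.eq_univ_of_forall fun i => ?_
      obtain ⟨x, hx, rfl⟩ : i ∈ Γ.typ '' C := hC.2 ▸ Set.mem_univ i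
      obtain ⟨b, hab, rfl⟩ := hf.exists_lift (hC.1 _ (hFC ⟨a, ha, rfl⟩) x hx)
      exact ⟨b, ⟨hab, hx⟩, (hf.typ_eq b).symm⟩
  intro F hF
  rcases F.eq_empty_or_nonempty with rfl | hne
  · obtain ⟨C, hC, -⟩ := key {Classical.arbitrary Y}
      (by rintro _ rfl _ rfl; exact Γ'.inc_refl _) ⟨_, rfl⟩
    exact ⟨C, hC, Set.empty_subset C⟩
  · exact key F hF hne

/-! ### Transport along walks in a covering -/

open Classical in
/-- The element over `x` that is incident with `z`, for `x` incident with `k z`, where `k` is a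
covering (and `z` itself for other `x`). -/
noncomputable def step (Γ'' : Pregeometry Z I) (k : Z → X) (z : Z) (x : X) : Z :=
  if h : ∃ z', Γ''.Inc z z' ∧ k z' = x then h.choose else z

theorem IsCovering.step_spec (hk : IsCovering Γ'' Γ k) {z : Z} {x : X} (h : Γ.Inc (k z) x) :
    Γ''.Inc z (step Γ'' k z x) ∧ k (step Γ'' k z x) = x := by
  rw [step, dif_pos (hk.exists_lift h)]
  exact (hk.exists_lift h).choose_spec

theorem IsCovering.step_eq (hk : IsCovering Γ'' Γ k) {z z' : Z} {x : X} (h : Γ''.Inc z z')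
    (hx : k z' = x) : step Γ'' k z x = z' := by
  have := hk.step_spec (hx ▸ hk.map_inc _ _ h)
  exact hk.eq_of_inc this.1 h (this.2.trans hx.symm)

/-- Transport of `z` in a covering `k` along the image under `f` of a walk: the end of the lift
that starts at `z`. -/
noncomputable def transport (Γ'' : Pregeometry Z I) (k : Z → X) (f : Y → X) {a b : Y} :
    Γ'.incGraph.Walk a b → Z → Z
  | .nil, z => z
  | .cons (v := c) _ p, z => transport Γ'' k f p (step Γ'' k z (f c))

theorem transport_append {a b c : Y} (p : Γ'.incGraph.Walk a b) (q : Γ'.incGraph.Walk b c)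
    (z : Z) : transport Γ'' k f (p.append q) z = transport Γ'' k f q (transport Γ'' k f p z) := by
  induction p generalizing z with
  | nil => rfl
  | cons h p ih => exact ih _ _

theorem IsCovering.map_transport (hk : IsCovering Γ'' Γ k)
    (hf : ∀ a b, Γ'.Inc a b → Γ.Inc (f a) (f b)) {a b : Y} (p : Γ'.incGraph.Walk a b) {z : Z}
    (hz : k z = f a) : k (transport Γ'' k f p z) = f b := by
  induction p generalizing z with
  | nil => exact hz
  | cons h p ih => exact ih (hk.step_spec (hz ▸ hf _ _ h.2)).2

/-- Returns and triangles lift to returns and triangles, so transport depends only on the homotopy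
class of the walk. -/
theorem IsCovering.transport_homotopic (hk : IsCovering Γ'' Γ k)
    (hf : ∀ a b, Γ'.Inc a b → Γ.Inc (f a) (f b)) {a b : Y} {p q : Γ'.incGraph.Walk a b}
    (h : Γ'.Homotopic p q) {z : Z} (hz : k z = f a) :
    transport Γ'' k f p z = transport Γ'' k f q z := by
  induction h with
  | refl p => rfl
  | symm p q _ ih => exact ih.symm
  | trans p q r _ _ ih₁ ih₂ => exact ih₁.trans ih₂
  | rel p q h =>
    cases h with
    | ret p h q =>
      rw [transport_append, transport_append]
      refine congrArg (transport Γ'' k f q) ?_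
      have h₀ := hk.map_transport hf p hz
      exact hk.step_eq (Γ''.inc_symm (hk.step_spec (h₀ ▸ hf _ _ h.2)).1) h₀
    | @triangle d e g p h₁ h₂ h₃ q =>
      rw [transport_append, transport_append]
      refine congrArg (transport Γ'' k f q) ?_
      set z₀ := transport Γ'' k f p z
      have h₀ : k z₀ = f d := hk.map_transport hf p hz
      obtain ⟨i₁, m₁⟩ := hk.step_spec (x := f e) (h₀ ▸ hf _ _ h₁.2)
      obtain ⟨i₂, m₂⟩ := hk.step_spec (x := f g) (m₁ ▸ hf _ _ h₂.2)
      refine hk.step_eq ?_ h₀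
      exact hk.inc_of_inc i₂ (Γ''.inc_symm i₁) (by rw [m₂, h₀]; exact hf _ _ h₃.2)

/-- Transport along a walk is computed by any homomorphism over the base. -/
theorem IsCovering.transport_map (hk : IsCovering Γ'' Γ k) {r : Y → Z}
    (hr : ∀ a b, Γ'.Inc a b → Γ''.Inc (r a) (r b)) (hrf : ∀ a, k (r a) = f a) {a b : Y}
    (p : Γ'.incGraph.Walk a b) : transport Γ'' k f p (r a) = r b := by
  induction p with
  | nil => rfl
  | cons h p ih =>
    rw [transport, hk.step_eq (hr _ _ h.2) (hrf _), ih]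

end Covering

/-- A covering by a simply connected pregeometry is universal. -/
theorem IsCovering.isUniversalCovering {X : Type u} {Y : Type v} {I : Type*}
    {Γ' : Pregeometry Y I} {Γ : Pregeometry X I} {f : Y → X} (hf : IsCovering Γ' Γ f)
    (hΓ' : Γ'.IsSimplyConnected) : IsUniversalCovering.{u, v, w} Γ' Γ f := by
  refine ⟨hf, fun Z Γ'' k _ hconn hk y z hyz => ?_⟩
  let t : ∀ b, Γ'.incGraph.Walk y b := fun b => (hΓ'.1.preconnected y b).some
  let r : Y → Z := fun b => transport Γ'' k f (t b) z
  have hr : ∀ {b} (p : Γ'.incGraph.Walk y b), r b = transport Γ'' k f p z := fun p =>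
    hk.transport_homotopic hf.map_inc (hΓ'.homotopic _ p) hyz.symm
  have hkr : ∀ b, k (r b) = f b := fun b => hk.map_transport hf.map_inc (t b) hyz.symm
  have hinc : ∀ b c, Γ'.Inc b c → Γ''.Inc (r b) (r c) := by
    intro b c hbc
    by_cases h : b = c
    · exact h ▸ Γ''.inc_refl _
    · have hadj : Γ'.incGraph.Adj b c := ⟨h, hbc⟩
      rw [hr ((t b).append (.cons hadj .nil)), transport_append]
      exact (hk.step_spec (by rw [hkr]; exact hf.map_inc _ _ hbc)).1
  have hlift : ∀ b z', Γ''.Inc (r b) z' → ∃ c, Γ'.Inc b c ∧ r c = z' := by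
    intro b z' h
    obtain ⟨c, hbc, hc⟩ := hf.exists_lift (a := b) (x := k z') (hkr b ▸ hk.map_inc _ _ h)
    exact ⟨c, hbc, hk.eq_of_inc (hinc _ _ hbc) h ((hkr c).trans hc)⟩
  have : Nonempty Y := ⟨y⟩
  refine ⟨r, ⟨isCovering_of_lift (fun b => ?_) hinc (surjective_of_lift hconn hlift) hlift
    fun a b c hab hac h => ?_, funext hkr, hr .nil⟩, ?_⟩
  · rw [← hk.typ_eq, hkr, hf.typ_eq]
  · exact hf.inc_of_inc hab hac (hkr b ▸ hkr c ▸ hk.map_inc _ _ h)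
  · rintro r' ⟨hr', hkr', rfl⟩
    funext b
    exact (hk.transport_map hr'.map_inc (congrFun hkr') (t b)).symm

/-! ### The fundamental group as a group of deck transformations -/

section Deck

variable {Γ : Pregeometry X I} {Γ' : Pregeometry Y I} {f : Y → X}

theorem IsCovering.map_adj (hf : IsCovering Γ' Γ f) {a b : Y} (h : Γ'.incGraph.Adj a b) :
    Γ.incGraph.Adj (f a) (f b) :=
  ⟨fun e => h.1 (hf.eq_of_inc (Γ'.inc_refl a) h.2 e), hf.map_inc _ _ h.2⟩

/-- A covering as a homomorphism of incidence graphs. -/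
def IsCovering.graphHom (hf : IsCovering Γ' Γ f) : Γ'.incGraph →g Γ.incGraph :=
  ⟨f, fun h => hf.map_adj h⟩

theorem IsCovering.homotopic_map (hf : IsCovering Γ' Γ f) {a b : Y} {p q : Γ'.incGraph.Walk a b}
    (h : Γ'.Homotopic p q) : Γ.Homotopic (p.map hf.graphHom) (q.map hf.graphHom) := by
  refine eqvGen_map (fun p : Γ'.incGraph.Walk a b => p.map hf.graphHom) (fun p q h => ?_) h
  cases h with
  | ret p h q =>
    simp only [SimpleGraph.Walk.map_append, SimpleGraph.Walk.map_cons]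
    exact .ret _ (hf.graphHom.map_adj h) _
  | triangle p h₁ h₂ h₃ q =>
    simp only [SimpleGraph.Walk.map_append, SimpleGraph.Walk.map_cons]
    exact .triangle _ (hf.graphHom.map_adj h₁) (hf.graphHom.map_adj h₂)
      (hf.graphHom.map_adj h₃) _

theorem IsCovering.transport_of_map (hf : IsCovering Γ' Γ f) {a b : Y}
    (p : Γ'.incGraph.Walk a b) :
    transport Γ' f id (p.map hf.graphHom) a = b := by
  induction p with
  | nil => rfl
  | cons h p ih =>
    rw [SimpleGraph.Walk.map_cons, transport]
    exact (congrArg _ (hf.step_eq h.2 rfl)).trans ih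

theorem IsCovering.exists_walk_lift (hf : IsCovering Γ' Γ f) {x y : X} (p : Γ.incGraph.Walk x y)
    {a : Y} (ha : f a = x) :
    ∃ (b : Y) (hb : f b = y) (q : Γ'.incGraph.Walk a b),
      (q.map hf.graphHom).copy ha hb = p ∧ transport Γ' f id p a = b := by
  induction p generalizing a with
  | nil => exact ⟨a, ha, .nil, by subst ha; rfl, rfl⟩
  | @cons x c y h p ih =>
    subst ha
    obtain ⟨hac, hc⟩ := hf.step_spec h.2
    obtain ⟨b, hb, q, hq, ht⟩ := ih hc
    have hne : a ≠ step Γ' f a c := fun e => h.1 (by rw [← hc, ← e])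
    refine ⟨b, hb, .cons ⟨hne, hac⟩ q, ?_, ht⟩
    subst hb hq
    generalize step Γ' f a c = d at *
    subst hc
    rfl

variable {U G : Type*} [Group U] [Group G] [MulAction U Y]

/-- Deck transformations commute with transport. -/
theorem IsCovering.transport_smul (hf : IsCovering Γ' Γ f) (haut : Γ'.ActsByAutomorphisms U)
    {u : U} (hu : ∀ a, f (u • a) = f a) {x y : X} (p : Γ.incGraph.Walk x y) {a : Y}
    (ha : f a = x) : transport Γ' f id p (u • a) = u • transport Γ' f id p a := by
  induction p generalizing a with
  | nil => rfl
  | @cons x c y h p ih =>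
    subst ha
    obtain ⟨hac, hc⟩ := hf.step_spec h.2
    refine Eq.trans ?_ (ih hc)
    exact congrArg _ (hf.step_eq (((haut u).2 _ _).2 hac) ((hu _).trans hc))

/-- The fundamental group as the group of deck transformations of a simply connected covering: if
`U` acts on the covering over an action of a quotient of `U`, and the kernel `N` of the quotient map
acts regularly on the fibres, then the closed walks at `x` are identified with the elements
of `N` that move a fixed element over `x` to the end of the lift. -/
theorem IsCovering.exists_groupExtension (hf : IsCovering Γ' Γ f) (hΓ' : Γ'.IsSimplyConnected)
    (haut : Γ'.ActsByAutomorphisms U) (ψ : U →* G) (hψ : Function.Surjective ψ)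
    (hker : ∀ u, ψ u = 1 → ∀ a, f (u • a) = f a)
    (hfree : ∀ u, ψ u = 1 → ∀ a : Y, u • a = a → u = 1)
    (htrans : ∀ a b, f a = f b → ∃ u, ψ u = 1 ∧ u • a = b) (x : X) :
    ∃ S : GroupExtension (Γ.FundamentalGroup x) U G, S.rightHom = ψ := by
  obtain ⟨a, rfl⟩ := hf.surjective x
  have hid : ∀ x y, Γ.Inc x y → Γ.Inc (id x) (id y) := fun _ _ h => h
  have hex : ∀ p : Γ.incGraph.Walk (f a) (f a), ∃ u, ψ u = 1 ∧ u • a = transport Γ' f id p a :=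
    fun p => htrans _ _ (hf.map_transport hid p rfl).symm
  choose d hd₁ hd₂ using hex
  have huniq : ∀ {u u'}, ψ u = 1 → ψ u' = 1 → u • a = u' • a → u = u' := by
    intro u u' hu hu' h
    refine (inv_mul_eq_one.1 (hfree (u'⁻¹ * u) (by simp [hu, hu']) a ?_)).symm
    rw [mul_smul, h, inv_smul_smul]
  let D : Γ.FundamentalGroup (f a) → U := Quotient.lift (s := Γ.homotopySetoid (f a) (f a)) d
    fun p q h => huniq (hd₁ p) (hd₁ q) (by
      rw [hd₂, hd₂, hf.transport_homotopic hid h rfl])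
  have hD : ∀ p, D (Γ.loopClass p) = d p := fun _ => rfl
  let Φ : Γ.FundamentalGroup (f a) →* U := MonoidHom.mk' D fun s t => by
    obtain ⟨p, rfl⟩ := Γ.loopClass_surjective _ s
    obtain ⟨q, rfl⟩ := Γ.loopClass_surjective _ t
    rw [← loopClass_append, hD, hD, hD]
    refine huniq (hd₁ _) (by simp [hd₁]) ?_
    rw [mul_smul, hd₂, hd₂, transport_append, ← hd₂ p,
      hf.transport_smul haut (hker _ (hd₁ p)) q rfl]
  refine ⟨⟨Φ, ψ, (injective_iff_map_eq_one Φ).2 fun s hs => ?_, ?_, hψ⟩, rfl⟩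
  · obtain ⟨p, rfl⟩ := Γ.loopClass_surjective _ s
    have hs' : transport Γ' f id p a = a := by
      rw [← hd₂, show d p = 1 from hs, one_smul]
    obtain ⟨b, hb, q, hq, ht⟩ := hf.exists_walk_lift p rfl
    obtain rfl : b = a := ht.symm.trans hs'
    rw [← loopClass_nil, loopClass_eq_iff, ← hq]
    exact hf.homotopic_map (hΓ'.homotopic q .nil)
  · ext u
    constructor
    · rintro ⟨s, rfl⟩
      obtain ⟨p, rfl⟩ := Γ.loopClass_surjective _ s
      exact hd₁ p
    · intro hu
      have hua := hker u hu a
      let q := (hΓ'.1.preconnected a (u • a)).some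
      refine ⟨Γ.loopClass ((q.map hf.graphHom).copy rfl hua), huniq (hd₁ _) hu ?_⟩
      refine (hd₂ _).trans ?_
      have : ∀ {y : X} (p : Γ.incGraph.Walk (f a) y) (h : y = f a),
          transport Γ' f id (p.copy rfl h) a = transport Γ' f id p a := by
        rintro y p rfl; rfl
      exact (this _ hua).trans (hf.transport_of_map q)

end Deck

end Pregeometry

/-! ### Cosets over the path with three vertices -/

section PathCoset

variable {U : Type*} [Group U]

/-- The coset of `u` of type `i`, as an element of the diagram coset pregeometry. -/
abbrev cosetElement (H : Fin 3 → Unit → Subgroup U) (i : Fin 3) (u : U) : DiagramCosetElement H :=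
  ⟨i, (), QuotientGroup.mk u⟩

/-- The diagram coset pregeometry over the path with vertices `0`, `1`, `2`. -/
abbrev pathCosetPregeometry (H : Fin 3 → Unit → Subgroup U) :
    Pregeometry (DiagramCosetElement H) (Fin 3) :=
  diagramCosetPregeometry (SimpleGraph.pathGraph 3) H

theorem pathGraph_three_adj_iff (i j : Fin 3) :
    (SimpleGraph.pathGraph 3).Adj i j ↔ i ≠ j ∧ (i = 1 ∨ j = 1) := by
  rw [SimpleGraph.pathGraph_adj]
  revert i j
  decide

variable {H : Fin 3 → Unit → Subgroup U}

theorem exists_eq_cosetElement (a : DiagramCosetElement H) : ∃ i u, a = cosetElement H i u := by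
  obtain ⟨i, ⟨⟩, q⟩ := a
  obtain ⟨u, rfl⟩ := QuotientGroup.mk_surjective q
  exact ⟨i, u, rfl⟩

theorem smul_cosetElement (u x : U) (i : Fin 3) :
    u • cosetElement H i x = cosetElement H i (u * x) := rfl

theorem cosetElement_eq_iff {i : Fin 3} {x y : U} :
    cosetElement H i x = cosetElement H i y ↔ x⁻¹ * y ∈ H i () := by
  rw [← QuotientGroup.eq]
  constructor
  · intro h
    simpa using h
  · intro h
    rw [cosetElement, h]

theorem mem_carrier_iff {i : Fin 3} {x y : U} :
    y ∈ (cosetElement H i x).carrier ↔ cosetElement H i x = cosetElement H i y := by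
  rw [cosetElement_eq_iff, ← QuotientGroup.eq, eq_comm]
  rfl

theorem pathCoset_adj_iff {a b : DiagramCosetElement H} :
    (diagramCosetGraph (SimpleGraph.pathGraph 3) H).Adj a b ↔
      ∃ i j z, (SimpleGraph.pathGraph 3).Adj i j ∧ a = cosetElement H i z ∧
        b = cosetElement H j z := by
  obtain ⟨i, x, rfl⟩ := exists_eq_cosetElement a
  obtain ⟨j, y, rfl⟩ := exists_eq_cosetElement b
  constructor
  · rintro ⟨h, z, hz₁, hz₂⟩
    exact ⟨i, j, z, h, mem_carrier_iff.1 hz₁, mem_carrier_iff.1 hz₂⟩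
  · rintro ⟨i', j', z, h, h₁, h₂⟩
    obtain rfl : i = i' := congrArg Sigma.fst h₁
    obtain rfl : j = j' := congrArg Sigma.fst h₂
    exact ⟨h, z, mem_carrier_iff.2 h₁, mem_carrier_iff.2 h₂⟩

theorem pathGraph_three_dist {i j : Fin 3} (hij : i ≠ j)
    (h : ¬ (SimpleGraph.pathGraph 3).Adj i j) : (SimpleGraph.pathGraph 3).dist i j = 2 := by
  have h₁ : (SimpleGraph.pathGraph 3).Adj i 1 ∧ (SimpleGraph.pathGraph 3).Adj 1 j := by
    simp only [pathGraph_three_adj_iff] at h ⊢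
    revert i j
    decide
  let p : (SimpleGraph.pathGraph 3).Walk i j := .cons h₁.1 (.cons h₁.2 .nil)
  have hle : (SimpleGraph.pathGraph 3).dist i j ≤ 2 := SimpleGraph.dist_le p
  have h0 : (SimpleGraph.pathGraph 3).dist i j ≠ 0 := fun h0 =>
    hij ((SimpleGraph.Reachable.dist_eq_zero_iff ⟨p⟩).1 h0)
  have h1 : (SimpleGraph.pathGraph 3).dist i j ≠ 1 := fun h1 =>
    h (SimpleGraph.dist_eq_one_iff_adj.1 h1)
  omega

/-- Incidence in the coset pregeometry: cosets of adjacent types are incident if they have a common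
representative, and cosets of the types `0` and `2` are incident if some coset of type `1` meets
both of them. -/
theorem pathCoset_inc_iff {a b : DiagramCosetElement H} :
    (pathCosetPregeometry H).Inc a b ↔ a = b ∨
      (∃ i j z, (SimpleGraph.pathGraph 3).Adj i j ∧ a = cosetElement H i z ∧
        b = cosetElement H j z) ∨
      (∃ i j z z', i ≠ j ∧ ¬ (SimpleGraph.pathGraph 3).Adj i j ∧ a = cosetElement H i z ∧
        cosetElement H 1 z = cosetElement H 1 z' ∧ b = cosetElement H j z') := by
  refine or_congr Iff.rfl (or_congr pathCoset_adj_iff ?_)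
  constructor
  · rintro ⟨h₁, h₂, p, hp⟩
    rw [pathGraph_three_dist h₁ h₂] at hp
    cases p with
    | nil => simp at hp
    | cons h p =>
      cases p with
      | nil => simp at hp
      | cons h' p =>
        cases p with
        | cons _ _ => simp at hp
        | nil =>
          obtain ⟨i, m, z, him, rfl, rfl⟩ := pathCoset_adj_iff.1 h
          obtain ⟨m', j, z', hmj, h₃, rfl⟩ := pathCoset_adj_iff.1 h'
          obtain rfl : m = m' := congrArg Sigma.fst h₃
          obtain rfl : m = 1 := by
            simp only [pathGraph_three_adj_iff] at him hmj h₂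
            simp only at h₁
            clear h h' h₃ hp
            revert i m j
            decide
          exact ⟨i, j, z, z', h₁, h₂, rfl, h₃, rfl⟩
  · rintro ⟨i, j, z, z', h₁, h₂, rfl, h₃, rfl⟩
    have h : (SimpleGraph.pathGraph 3).Adj i 1 ∧ (SimpleGraph.pathGraph 3).Adj 1 j := by
      clear h₃
      simp only [pathGraph_three_adj_iff] at h₂ ⊢
      revert i j
      decide
    refine ⟨h₁, h₂, .cons (pathCoset_adj_iff.2 ⟨i, 1, z, h.1, rfl, rfl⟩)
      (.cons (pathCoset_adj_iff.2 ⟨1, j, z', h.2, h₃, rfl⟩) .nil), ?_⟩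
    exact (pathGraph_three_dist h₁ h₂).symm

theorem pathCoset_inc_same (i j : Fin 3) (z : U) :
    (pathCosetPregeometry H).Inc (cosetElement H i z) (cosetElement H j z) := by
  rw [pathCoset_inc_iff]
  by_cases hij : i = j
  · exact Or.inl (by rw [hij])
  by_cases h : (SimpleGraph.pathGraph 3).Adj i j
  · exact Or.inr (Or.inl ⟨i, j, z, h, rfl, rfl⟩)
  · exact Or.inr (Or.inr ⟨i, j, z, z, hij, h, rfl, rfl, rfl⟩)

theorem exists_of_pathCoset_inc {i j : Fin 3} (hij : (SimpleGraph.pathGraph 3).Adj i j) {x y : U}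
    (h : (pathCosetPregeometry H).Inc (cosetElement H i x) (cosetElement H j y)) :
    ∃ z, cosetElement H i x = cosetElement H i z ∧ cosetElement H j y = cosetElement H j z := by
  rcases pathCoset_inc_iff.1 h with h | ⟨i', j', z, -, h₁, h₂⟩ | ⟨i', j', z, z', -, h', h₁, -, h₂⟩
  · exact absurd (congrArg Sigma.fst h) hij.ne
  all_goals
    obtain rfl : i = i' := congrArg Sigma.fst h₁
    obtain rfl : j = j' := congrArg Sigma.fst h₂
  · exact ⟨z, h₁, h₂⟩
  · exact absurd hij h'

theorem exists_of_pathCoset_inc_zero_two {x y : U}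
    (h : (pathCosetPregeometry H).Inc (cosetElement H 0 x) (cosetElement H 2 y)) :
    ∃ z z', cosetElement H 0 x = cosetElement H 0 z ∧ cosetElement H 1 z = cosetElement H 1 z' ∧
      cosetElement H 2 y = cosetElement H 2 z' := by
  rcases pathCoset_inc_iff.1 h with h | ⟨i', j', z, h', h₁, h₂⟩ | ⟨i', j', z, z', -, -, h₁, h₃, h₂⟩
  · exact absurd (congrArg Sigma.fst h) (show (0 : Fin 3) ≠ 2 by decide)
  all_goals
    obtain rfl : 0 = i' := congrArg Sigma.fst h₁
    obtain rfl : 2 = j' := congrArg Sigma.fst h₂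
  · exact absurd ((pathGraph_three_adj_iff _ _).1 h') (by decide)
  · exact ⟨z, z', h₁, h₃, h₂⟩

/-- A generalised digon: an element of type `1` makes the elements of other types that are incident
with it incident with each other. -/
theorem pathCoset_inc_of_inc_one {i j : Fin 3} (hi : i ≠ 1) (hj : j ≠ 1) (hij : i ≠ j) {x y z : U}
    (h₁ : (pathCosetPregeometry H).Inc (cosetElement H i x) (cosetElement H 1 z))
    (h₂ : (pathCosetPregeometry H).Inc (cosetElement H 1 z) (cosetElement H j y)) :
    (pathCosetPregeometry H).Inc (cosetElement H i x) (cosetElement H j y) := by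
  obtain ⟨t, ht₁, ht₂⟩ := exists_of_pathCoset_inc
    ((pathGraph_three_adj_iff _ _).2 ⟨hi, Or.inr rfl⟩) h₁
  obtain ⟨t', ht₁', ht₂'⟩ := exists_of_pathCoset_inc
    ((pathGraph_three_adj_iff _ _).2 ⟨hj.symm, Or.inl rfl⟩) h₂
  refine pathCoset_inc_iff.2 (Or.inr (Or.inr ⟨i, j, t, t', hij, ?_, ht₁, ht₂ ▸ ht₁', ht₂'⟩))
  rw [pathGraph_three_adj_iff]
  rintro ⟨-, h | h⟩
  exacts [hi h, hj h]

theorem pathCoset_actsByAutomorphisms : (pathCosetPregeometry H).ActsByAutomorphisms U := by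
  have key : ∀ (u : U) a b, (pathCosetPregeometry H).Inc a b →
      (pathCosetPregeometry H).Inc (u • a) (u • b) := by
    intro u a b h
    rw [pathCoset_inc_iff] at h ⊢
    rcases h with rfl | ⟨i, j, z, h, rfl, rfl⟩ | ⟨i, j, z, z', h₁, h₂, rfl, h₃, rfl⟩
    · exact Or.inl rfl
    · exact Or.inr (Or.inl ⟨i, j, u * z, h, rfl, rfl⟩)
    · exact Or.inr (Or.inr ⟨i, j, u * z, u * z', h₁, h₂, rfl, congrArg (u • ·) h₃, rfl⟩)
  refine fun u => ⟨fun a => rfl, fun a b => ⟨fun h => ?_, key u a b⟩⟩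
  simpa using key u⁻¹ _ _ h

theorem pathCoset_reachable_of_inc {a b : DiagramCosetElement H}
    (h : (pathCosetPregeometry H).Inc a b) :
    (pathCosetPregeometry H).incGraph.Reachable a b := by
  by_cases hab : a = b
  · exact hab ▸ .refl _
  · exact SimpleGraph.Adj.reachable ⟨hab, h⟩

/-- The coset pregeometry is connected if the subgroups generate the group. -/
theorem pathCoset_isConnected (hgen : ∀ K : Subgroup U, (∀ i, H i () ≤ K) → K = ⊤) :
    (pathCosetPregeometry H).IsConnected := by
  let R := (pathCosetPregeometry H).incGraph.Reachable
  let K : Subgroup U :=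
    { carrier := {u | ∀ z, R (cosetElement H 1 z) (cosetElement H 1 (z * u))}
      one_mem' := fun z => by rw [mul_one]
      mul_mem' := fun {a b} ha hb z => by rw [← mul_assoc]; exact (ha z).trans (hb _)
      inv_mem' := fun {a} ha z => by
        have h := (ha (z * a⁻¹)).symm
        rwa [inv_mul_cancel_right] at h }
  have hK : K = ⊤ := hgen K fun i l hl z => by
    have h : cosetElement H i z = cosetElement H i (z * l) := cosetElement_eq_iff.2 (by
      rwa [inv_mul_cancel_left])
    refine (pathCoset_reachable_of_inc (pathCoset_inc_same 1 i z)).trans ?_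
    rw [h]
    exact pathCoset_reachable_of_inc (pathCoset_inc_same i 1 _)
  have key : ∀ a, R (cosetElement H 1 1) a := by
    intro a
    obtain ⟨i, u, rfl⟩ := exists_eq_cosetElement a
    have hu : u ∈ K := hK ▸ Subgroup.mem_top u
    have := hu 1
    rw [one_mul] at this
    exact this.trans (pathCoset_reachable_of_inc (pathCoset_inc_same 1 i u))
  exact (SimpleGraph.connected_iff _).2
    ⟨fun a b => (key a).symm.trans (key b), ⟨cosetElement H 1 1⟩⟩

/-- A homomorphism `Φ` from `U` to the semidirect product of the edge group with `U` that is
conjugation by the edge from the base coset of type `1` to that of type `i` on the subgroup of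
type `i` provides a potential for the edges, so that the coset pregeometry is simply connected. -/
theorem pathCoset_isSimplyConnected (hconn : (pathCosetPregeometry H).IsConnected)
    (Φ : U →* (pathCosetPregeometry H).EdgeGroup ⋊[Pregeometry.edgeAction
      (pathCoset_actsByAutomorphisms (H := H))] U)
    (hΦ : ∀ i, ∀ l ∈ H i (), Φ l =
      .inl ((pathCosetPregeometry H).edge (cosetElement H 1 1) (cosetElement H i 1)) * .inr l *
      (.inl ((pathCosetPregeometry H).edge (cosetElement H 1 1) (cosetElement H i 1)))⁻¹) :
    (pathCosetPregeometry H).IsSimplyConnected := by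
  let E : Fin 3 → (pathCosetPregeometry H).EdgeGroup ⋊[Pregeometry.edgeAction
      (pathCoset_actsByAutomorphisms (H := H))] U := fun i =>
    .inl ((pathCosetPregeometry H).edge (cosetElement H 1 1) (cosetElement H i 1))
  let c : DiagramCosetElement H → (pathCosetPregeometry H).EdgeGroup ⋊[Pregeometry.edgeAction
      (pathCoset_actsByAutomorphisms (H := H))] U := fun a =>
    Φ (Quotient.out a.2.2) * E a.1 * (.inr (Quotient.out a.2.2))⁻¹
  have hc : ∀ i u, c (cosetElement H i u) = Φ u * E i * (.inr u)⁻¹ := by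
    intro i u
    obtain ⟨l, hl⟩ := QuotientGroup.mk_out_eq_mul (H i ()) u
    change Φ (Quotient.out (QuotientGroup.mk u : U ⧸ H i ())) * E i * (.inr (Quotient.out _))⁻¹ = _
    rw [hl, map_mul, map_mul, hΦ i l l.2, mul_inv_rev]
    simp only [E, mul_assoc, inv_mul_cancel_left, mul_inv_cancel_left]
  have hstep : ∀ i j u, c (cosetElement H i u) * SemidirectProduct.inl
      ((pathCosetPregeometry H).edge (cosetElement H i u) (cosetElement H j u)) =
      c (cosetElement H j u) := by
    intro i j u
    have h₁ : ∀ k, cosetElement H k u = u • cosetElement H k 1 := fun k => by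
      rw [smul_cosetElement, mul_one]
    have h₂ : (pathCosetPregeometry H).edge (cosetElement H i u) (cosetElement H j u) =
        Pregeometry.edgeAction (pathCoset_actsByAutomorphisms (H := H)) u
          ((pathCosetPregeometry H).edge (cosetElement H i 1) (cosetElement H j 1)) := by
      rw [Pregeometry.edgeAction_edge, ← h₁, ← h₁]
    have h₃ : E j = E i * .inl
        ((pathCosetPregeometry H).edge (cosetElement H i 1) (cosetElement H j 1)) := by
      simp only [E]
      rw [← map_mul, Pregeometry.edge_mul_edge _ (pathCoset_inc_same _ _ _)
        (pathCoset_inc_same _ _ _) (pathCoset_inc_same _ _ _)]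
    rw [hc, hc, h₂, SemidirectProduct.inl_aut, h₃, map_inv]
    simp only [mul_assoc, inv_mul_cancel_left]
  refine Pregeometry.isSimplyConnected_of_potential hconn SemidirectProduct.inl
    SemidirectProduct.inl_injective c fun a b h => ?_
  rcases pathCoset_inc_iff.1 h with rfl | ⟨i, j, z, -, rfl, rfl⟩ | ⟨i, j, z, z', -, -, rfl, h₃, rfl⟩
  · simp
  · exact hstep i j z
  · rw [← Pregeometry.edge_mul_edge _ (pathCoset_inc_same i 1 z)
      (h₃ ▸ pathCoset_inc_same 1 j z') h, map_mul, ← mul_assoc, hstep, h₃, hstep]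

end PathCoset

/-! ### Relations in the universal enveloping group of the parabolics -/

section ParabolicEnvelope

variable {X : Type u} {G : Type v} [Group G] [MulAction G X]

/-- The universal enveloping group of the fused amalgam of parabolics. -/
abbrev ParabolicEnvelope (w : Fin 3 → X) (g : G) (hg : g • w 1 = w 1) : Type v :=
  (fusedAmalgamOfParabolics w g hg).UniversalEnvelopingGroup

/-- The canonical homomorphism from a parabolic to the universal enveloping group. -/
def parabolicHom (w : Fin 3 → X) (g : G) (hg : g • w 1 = w 1) (S : ParabolicIndex) :
    parabolic w g S →* ParabolicEnvelope w g hg :=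
  (fusedAmalgamOfParabolics w g hg).toUniversal S

theorem parabolicHom_inclusion (w : Fin 3 → X) (g : G) (hg : g • w 1 = w 1) {S T : ParabolicIndex}
    (h : S ≤ T) (x : parabolic w g S) :
    parabolicHom w g hg T (Subgroup.inclusion (parabolic_mono w g h) x) =
      parabolicHom w g hg S x := by
  rcases eq_or_lt_of_le h with rfl | h
  · rfl
  · have h₁ := PresentedGroup.one_of_mem (rels := (fusedAmalgamOfParabolics w g hg).relators)
      (Or.inl (Or.inr ⟨S, T, h, x, rfl⟩))
    rw [map_mul, map_inv, mul_inv_eq_one] at h₁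
    exact h₁.symm

/-- The image of `g`, as an element of the stabiliser of `w 1`. -/
def envelopeElement (w : Fin 3 → X) (g : G) (hg : g • w 1 = w 1) : ParabolicEnvelope w g hg :=
  (fusedAmalgamOfParabolics w g hg).toUniversal (.single 1) (fusedAmalgamOfParabolics w g hg).g

theorem parabolicHom_fusion (w : Fin 3 → X) (g : G) (hg : g • w 1 = w 1)
    (x : parabolic w g (.single 2)) :
    parabolicHom w g hg (.single 3) ⟨g * x * g⁻¹, (conj_mem_parabolic_iff w g x).2 x.2⟩ =
      envelopeElement w g hg * parabolicHom w g hg (.single 2) x *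
        (envelopeElement w g hg)⁻¹ := by
  have h₁ := PresentedGroup.one_of_mem (rels := (fusedAmalgamOfParabolics w g hg).relators)
    (Or.inr ⟨x, rfl⟩)
  rw [map_mul, map_inv, mul_inv_eq_one, map_mul, map_mul, map_inv] at h₁
  exact h₁

theorem naturalHom_parabolicHom (w : Fin 3 → X) (g : G) (hg : g • w 1 = w 1) (S : ParabolicIndex)
    (x : parabolic w g S) : naturalHom w g hg (parabolicHom w g hg S x) = x :=
  (parabolicFamily w g hg).lift_toUniversal S x

@[simp]
theorem naturalHom_envelopeElement (w : Fin 3 → X) (g : G) (hg : g • w 1 = w 1) :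
    naturalHom w g hg (envelopeElement w g hg) = g :=
  naturalHom_parabolicHom w g hg (.single 1) _

theorem mem_parabolic_single {w : Fin 3 → X} {g : G} {i : Fin 4} {x : G} :
    x ∈ parabolic w g (.single i) ↔ x • parabolicElement w g i = parabolicElement w g i := by
  simp [mem_parabolic, ParabolicIndex.single, ParabolicIndex.toFinset]

theorem parabolicElement_castSucc (w : Fin 3 → X) (g : G) (i : Fin 3) :
    parabolicElement w g i.castSucc = w i := by
  fin_cases i <;> rfl

/-- The image in the universal enveloping group of the stabiliser of one of the four elements. -/
def stabilizerImage (w : Fin 3 → X) (g : G) (hg : g • w 1 = w 1) (i : Fin 4) :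
    Subgroup (ParabolicEnvelope w g hg) :=
  (parabolicHom w g hg (.single i)).range

variable {w : Fin 3 → X} {g : G} {hg : g • w 1 = w 1}

theorem naturalHom_smul_of_mem {i : Fin 4} {u : ParabolicEnvelope w g hg}
    (hu : u ∈ stabilizerImage w g hg i) :
    naturalHom w g hg u • parabolicElement w g i = parabolicElement w g i := by
  obtain ⟨x, rfl⟩ := hu
  rw [naturalHom_parabolicHom]
  exact mem_parabolic_single.1 x.2

theorem naturalHom_smul_of_mem_vertexSubgroup {i : Fin 3} {u : ParabolicEnvelope w g hg}
    (hu : u ∈ vertexSubgroup w g hg i ()) : naturalHom w g hg u • w i = w i := by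
  have h := naturalHom_smul_of_mem hu
  rwa [parabolicElement_castSucc] at h

theorem exists_mem_vertexSubgroup {i : Fin 3} {h : G} (hh : h • w i = w i) :
    ∃ u ∈ vertexSubgroup w g hg i (), naturalHom w g hg u = h :=
  ⟨_, ⟨⟨h, mem_parabolic_single.2 (by rwa [parabolicElement_castSucc])⟩, rfl⟩,
    naturalHom_parabolicHom w g hg _ _⟩

theorem eq_one_of_mem_vertexSubgroup {i : Fin 3} {u : ParabolicEnvelope w g hg}
    (hu : u ∈ vertexSubgroup w g hg i ()) (h : naturalHom w g hg u = 1) : u = 1 := by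
  obtain ⟨x, rfl⟩ := hu
  have hx : x = 1 := Subtype.ext ((naturalHom_parabolicHom w g hg _ x).symm.trans h)
  rw [hx, map_one]

theorem parabolicHom_mem_stabilizerImage {S : ParabolicIndex} {i : Fin 4} (hi : i ∈ S.toFinset)
    (x : parabolic w g S) : parabolicHom w g hg S x ∈ stabilizerImage w g hg i := by
  have h : S ≤ .single i := by
    change {i} ⊆ S.toFinset
    simpa using hi
  exact ⟨_, parabolicHom_inclusion w g hg h x⟩

/-- Two of the four elements other than the two planes form a flag, whose stabiliser is a member of
the amalgam. Hence the images of the two stabilisers meet in the image of that member. -/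
theorem mem_stabilizerImage_iff {i j : Fin 4}
    (hij : ¬ (2 ∈ ({i, j} : Finset (Fin 4)) ∧ 3 ∈ ({i, j} : Finset (Fin 4))))
    {u : ParabolicEnvelope w g hg}
    (hi : naturalHom w g hg u • parabolicElement w g i = parabolicElement w g i)
    (hj : naturalHom w g hg u • parabolicElement w g j = parabolicElement w g j) :
    u ∈ stabilizerImage w g hg i ↔ u ∈ stabilizerImage w g hg j := by
  let S : ParabolicIndex := OrderDual.toDual ⟨{i, j}, by simp, hij⟩
  have hS : ∀ k, k ∈ S.toFinset ↔ k = i ∨ k = j := fun k => by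
    simp [S, ParabolicIndex.toFinset]
  have key : ∀ k l, k ∈ S.toFinset → l ∈ S.toFinset → u ∈ stabilizerImage w g hg k →
      u ∈ stabilizerImage w g hg l := by
    rintro k l hk hl ⟨x, rfl⟩
    rw [naturalHom_parabolicHom] at hi hj
    have hx : (x : G) ∈ parabolic w g S := mem_parabolic.2 fun m hm => by
      rcases (hS m).1 hm with rfl | rfl <;> assumption
    have h : S ≤ .single k := by
      change {k} ⊆ S.toFinset
      simpa using hk
    have := parabolicHom_inclusion w g hg h ⟨x, hx⟩
    exact this ▸ parabolicHom_mem_stabilizerImage hl _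
  exact ⟨key i j ((hS i).2 (.inl rfl)) ((hS j).2 (.inr rfl)),
    key j i ((hS j).2 (.inr rfl)) ((hS i).2 (.inl rfl))⟩

/-- The fusion turns the stabiliser of `g • w 2` into a conjugate of the stabiliser of `w 2`. -/
theorem mem_stabilizerImage_three_iff {u : ParabolicEnvelope w g hg} :
    u ∈ stabilizerImage w g hg 3 ↔
      (envelopeElement w g hg)⁻¹ * u * envelopeElement w g hg ∈ vertexSubgroup w g hg 2 () := by
  constructor
  · rintro ⟨x, rfl⟩
    have hx : g⁻¹ * x * g ∈ parabolic w g (.single 2) :=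
      (conj_mem_parabolic_iff w g _).1 (by simp [mul_assoc])
    have h := parabolicHom_fusion w g hg ⟨g⁻¹ * x * g, hx⟩
    have h' : (⟨g * (g⁻¹ * x * g) * g⁻¹, (conj_mem_parabolic_iff w g _).2 hx⟩ :
        parabolic w g (.single 3)) = x := Subtype.ext (by simp [mul_assoc])
    rw [h'] at h
    refine ⟨⟨g⁻¹ * x * g, hx⟩, ?_⟩
    refine Eq.trans (b := parabolicHom w g hg (.single 2) ⟨g⁻¹ * x * g, hx⟩) rfl ?_
    rw [h]
    simp only [mul_assoc, inv_mul_cancel_left, inv_mul_cancel, mul_one]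
  · rintro ⟨x, hx⟩
    refine ⟨_, (parabolicHom_fusion w g hg x).trans ?_⟩
    rw [show parabolicHom w g hg (.single 2) x = _ from hx, mul_assoc, mul_assoc, mul_assoc,
      mul_inv_cancel, mul_one, mul_inv_cancel_left]

theorem envelopeElement_mem : envelopeElement w g hg ∈ vertexSubgroup w g hg 1 () := ⟨_, rfl⟩

/-- The stabilisers of `w 0`, `w 1`, `w 2` generate the universal enveloping group. -/
theorem eq_top_of_vertexSubgroup_le (K : Subgroup (ParabolicEnvelope w g hg))
    (hK : ∀ i, vertexSubgroup w g hg i () ≤ K) : K = ⊤ := by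
  have h : ∀ i, stabilizerImage w g hg i ≤ K := by
    intro i
    refine Fin.lastCases ?_ (fun i => hK i) i
    intro u hu
    have hmem := hK 2 (mem_stabilizerImage_three_iff.1 hu)
    have he := hK 1 envelopeElement_mem
    rwa [K.mul_mem_cancel_right he, K.mul_mem_cancel_left (K.inv_mem he)] at hmem
  refine (Subgroup.eq_top_iff' K).2 (PresentedGroup.generated_by _ K fun s => ?_)
  obtain ⟨i, hi⟩ : s.1.toFinset.Nonempty := (OrderDual.ofDual s.1).2.1
  exact h i (parabolicHom_mem_stabilizerImage hi s.2)

/-! ### The universal coset pregeometry is simply connected -/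

/-- The cosets over `w 0`, `w 1`, `w 2` and `g • w 2` that form two flags with a common
line. -/
def baseCoset (w : Fin 3 → X) (g : G) (hg : g • w 1 = w 1) :
    Fin 4 → DiagramCosetElement (vertexSubgroup w g hg) :=
  ![cosetElement _ 0 1, cosetElement _ 1 1, cosetElement _ 2 1,
    cosetElement _ 2 (envelopeElement w g hg)]

theorem baseCoset_castSucc (i : Fin 3) :
    baseCoset w g hg i.castSucc = cosetElement (vertexSubgroup w g hg) i 1 := by
  fin_cases i <;> rfl

theorem cosetElement_one_envelopeElement :
    cosetElement (vertexSubgroup w g hg) 1 (envelopeElement w g hg) = cosetElement _ 1 1 :=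
  (cosetElement_eq_iff.2 (by simpa using envelopeElement_mem)).symm

theorem baseCoset_inc {i j : Fin 4}
    (hij : ¬ (2 ∈ ({i, j} : Finset (Fin 4)) ∧ 3 ∈ ({i, j} : Finset (Fin 4)))) :
    (universalCosetPregeometry w g hg).Inc (baseCoset w g hg i) (baseCoset w g hg j) := by
  have h13 : (universalCosetPregeometry w g hg).Inc (baseCoset w g hg 1) (baseCoset w g hg 3) := by
    change (pathCosetPregeometry _).Inc (cosetElement _ 1 1) (cosetElement _ 2 _)
    rw [← cosetElement_one_envelopeElement]
    exact pathCoset_inc_same 1 2 _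
  have h03 : (universalCosetPregeometry w g hg).Inc (baseCoset w g hg 0) (baseCoset w g hg 3) :=
    pathCoset_inc_of_inc_one (by decide) (by decide) (by decide) (pathCoset_inc_same 0 1 1) h13
  have h33 := (universalCosetPregeometry w g hg).inc_refl (baseCoset w g hg 3)
  have key : ∀ i j : Fin 3, (universalCosetPregeometry w g hg).Inc (baseCoset w g hg i.castSucc)
      (baseCoset w g hg j.castSucc) := fun i j => by
    rw [baseCoset_castSucc, baseCoset_castSucc]
    exact pathCoset_inc_same i j 1
  have last : ∀ i : Fin 3, i.castSucc ≠ 2 → (universalCosetPregeometry w g hg).Inc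
      (baseCoset w g hg i.castSucc) (baseCoset w g hg 3) := fun i hi => by
    fin_cases i
    exacts [h03, h13, absurd rfl hi]
  induction i using Fin.lastCases with
  | last =>
    induction j using Fin.lastCases with
    | last => exact h33
    | cast j =>
      exact (universalCosetPregeometry w g hg).inc_symm (last j fun h => hij (by rw [h]; decide))
  | cast i =>
    induction j using Fin.lastCases with
    | last => exact last i fun h => hij (by rw [h]; decide)
    | cast j => exact key i j

theorem smul_baseCoset {i : Fin 4} {u : ParabolicEnvelope w g hg}
    (hu : u ∈ stabilizerImage w g hg i) : u • baseCoset w g hg i = baseCoset w g hg i := by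
  induction i using Fin.lastCases with
  | last =>
    refine (cosetElement_eq_iff (i := 2) (x := u * envelopeElement w g hg)
      (y := envelopeElement w g hg)).2 ?_
    rw [← inv_mem_iff, mul_inv_rev, inv_inv, ← mul_assoc]
    exact mem_stabilizerImage_three_iff.1 hu
  | cast i =>
    rw [baseCoset_castSucc, smul_cosetElement]
    exact cosetElement_eq_iff.2 (by
      rw [mul_one, mul_one]
      exact inv_mem hu)

/-- The action of the universal enveloping group on the edge group of the coset pregeometry. -/
def envelopeEdgeAction (w : Fin 3 → X) (g : G) (hg : g • w 1 = w 1) :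
    ParabolicEnvelope w g hg →* MulAut (universalCosetPregeometry w g hg).EdgeGroup :=
  Pregeometry.edgeAction (pathCoset_actsByAutomorphisms (H := vertexSubgroup w g hg))

/-- The edge from the base coset of type `1` to another base coset, in the semidirect product. -/
def baseEdge (w : Fin 3 → X) (g : G) (hg : g • w 1 = w 1) (i : Fin 4) :
    (universalCosetPregeometry w g hg).EdgeGroup ⋊[envelopeEdgeAction w g hg]
      ParabolicEnvelope w g hg :=
  .inl ((universalCosetPregeometry w g hg).edge (baseCoset w g hg 1) (baseCoset w g hg i))

theorem conj_inr_inl_edge (u : ParabolicEnvelope w g hg)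
    (a b : DiagramCosetElement (vertexSubgroup w g hg)) :
    (.inr u * .inl ((universalCosetPregeometry w g hg).edge a b) * (.inr u)⁻¹ :
      (universalCosetPregeometry w g hg).EdgeGroup ⋊[envelopeEdgeAction w g hg]
        ParabolicEnvelope w g hg) =
      .inl ((universalCosetPregeometry w g hg).edge (u • a) (u • b)) := by
  rw [← map_inv, ← SemidirectProduct.inl_aut]
  exact congrArg _ (Pregeometry.edgeAction_edge _ u a b)

/-- Conjugation by the edges to two incident base cosets agrees on the common stabiliser of these
cosets: the edge joining the two is fixed by it, and forms a triangle with the other two edges. -/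
theorem conj_baseEdge_eq {i j : Fin 4}
    (hij : ¬ (2 ∈ ({i, j} : Finset (Fin 4)) ∧ 3 ∈ ({i, j} : Finset (Fin 4))))
    {u : ParabolicEnvelope w g hg} (hi : u ∈ stabilizerImage w g hg i)
    (hj : u ∈ stabilizerImage w g hg j) :
    baseEdge w g hg i * .inr u * (baseEdge w g hg i)⁻¹ =
      baseEdge w g hg j * .inr u * (baseEdge w g hg j)⁻¹ := by
  have h1 : ∀ k : Fin 4, ¬ (2 ∈ ({1, k} : Finset (Fin 4)) ∧ 3 ∈ ({1, k} : Finset (Fin 4))) := by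
    decide
  have h := conj_inr_inl_edge u (baseCoset w g hg i) (baseCoset w g hg j)
  rw [smul_baseCoset hi, smul_baseCoset hj, mul_inv_eq_iff_eq_mul] at h
  have hE : baseEdge w g hg j = baseEdge w g hg i *
      .inl ((universalCosetPregeometry w g hg).edge (baseCoset w g hg i) (baseCoset w g hg j)) := by
    rw [baseEdge, baseEdge, ← map_mul, Pregeometry.edge_mul_edge _ (baseCoset_inc (h1 i))
      (baseCoset_inc hij) (baseCoset_inc (h1 j))]
  rw [hE, mul_assoc (baseEdge w g hg i) (.inl _), ← h]
  simp only [mul_assoc, mul_inv_rev, mul_inv_cancel_left]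

/-- An element of the finite set of an index. -/
noncomputable def ParabolicIndex.someMem (S : ParabolicIndex) : Fin 4 :=
  (OrderDual.ofDual S).2.1.choose

theorem ParabolicIndex.someMem_mem (S : ParabolicIndex) : S.someMem ∈ S.toFinset :=
  (OrderDual.ofDual S).2.1.choose_spec

theorem ParabolicIndex.someMem_single (i : Fin 4) : (ParabolicIndex.single i).someMem = i :=
  Finset.mem_singleton.1 (ParabolicIndex.single i).someMem_mem

theorem ParabolicIndex.not_mem_and_mem {S : ParabolicIndex} {i j : Fin 4} (hi : i ∈ S.toFinset)
    (hj : j ∈ S.toFinset) :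
    ¬ (2 ∈ ({i, j} : Finset (Fin 4)) ∧ 3 ∈ ({i, j} : Finset (Fin 4))) := by
  have hsub : ({i, j} : Finset (Fin 4)) ⊆ S.toFinset := by
    intro k hk
    rcases Finset.mem_insert.1 hk with rfl | hk
    · exact hi
    · exact Finset.mem_singleton.1 hk ▸ hj
  exact fun h => (OrderDual.ofDual S).2.2 ⟨hsub h.1, hsub h.2⟩

/-- The compatible family that conjugates the stabiliser of an element by the edge from the base
line to that element. -/
noncomputable def edgeFamily (w : Fin 3 → X) (g : G) (hg : g • w 1 = w 1) :
    (fusedAmalgamOfParabolics w g hg).CompatibleFamily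
      ((universalCosetPregeometry w g hg).EdgeGroup ⋊[envelopeEdgeAction w g hg]
        ParabolicEnvelope w g hg) where
  hom S := (MulAut.conj (baseEdge w g hg S.someMem)).toMonoidHom.comp
    (SemidirectProduct.inr.comp (parabolicHom w g hg S))
  hom_map {S T} h x := by
    have hT : T.someMem ∈ S.toFinset := h.le T.someMem_mem
    have hx : parabolicHom w g hg T ((fusedAmalgamOfParabolics w g hg).map h x) =
        parabolicHom w g hg S x := parabolicHom_inclusion w g hg h.le x
    change baseEdge w g hg _ * .inr (parabolicHom w g hg T _) * _ = baseEdge w g hg _ * .inr _ * _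
    rw [hx]
    exact conj_baseEdge_eq (ParabolicIndex.not_mem_and_mem hT S.someMem_mem)
      (parabolicHom_mem_stabilizerImage hT x)
      (parabolicHom_mem_stabilizerImage S.someMem_mem x)
  hom_fusion x := by
    have h1 : baseEdge w g hg 1 = 1 := by
      rw [baseEdge, Pregeometry.edge_self, map_one]
    have h3 : baseEdge w g hg 3 = .inr (envelopeElement w g hg) * baseEdge w g hg 2 *
        (.inr (envelopeElement w g hg))⁻¹ := by
      rw [baseEdge, baseEdge, conj_inr_inl_edge]
      have e1 : envelopeElement w g hg • baseCoset w g hg 1 = baseCoset w g hg 1 :=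
        smul_baseCoset (i := 1) envelopeElement_mem
      have e2 : envelopeElement w g hg • baseCoset w g hg 2 = baseCoset w g hg 3 := by
        change envelopeElement w g hg • cosetElement _ 2 1 = cosetElement _ 2 _
        rw [smul_cosetElement, mul_one]
      rw [e1, e2]
    change baseEdge w g hg (ParabolicIndex.single 3).someMem *
        .inr (parabolicHom w g hg (.single 3) ((fusedAmalgamOfParabolics w g hg).γ x)) *
        (baseEdge w g hg (ParabolicIndex.single 3).someMem)⁻¹ =
      (baseEdge w g hg (ParabolicIndex.single 1).someMem * .inr (envelopeElement w g hg) *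
        (baseEdge w g hg (ParabolicIndex.single 1).someMem)⁻¹) *
      (baseEdge w g hg (ParabolicIndex.single 2).someMem *
        .inr (parabolicHom w g hg (.single 2) x) *
        (baseEdge w g hg (ParabolicIndex.single 2).someMem)⁻¹) *
      (baseEdge w g hg (ParabolicIndex.single 1).someMem * .inr (envelopeElement w g hg) *
        (baseEdge w g hg (ParabolicIndex.single 1).someMem)⁻¹)⁻¹
    rw [ParabolicIndex.someMem_single, ParabolicIndex.someMem_single,
      ParabolicIndex.someMem_single, h1]
    have hf : parabolicHom w g hg (.single 3) ((fusedAmalgamOfParabolics w g hg).γ x) = _ :=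
      parabolicHom_fusion w g hg x
    rw [hf, h3, map_mul, map_mul, map_inv]
    simp only [mul_assoc, mul_inv_rev, inv_inv, inv_one, one_mul, mul_one, inv_mul_cancel_left]

theorem universalCoset_isConnected : (universalCosetPregeometry w g hg).IsConnected :=
  pathCoset_isConnected eq_top_of_vertexSubgroup_le

theorem universalCoset_isSimplyConnected :
    (universalCosetPregeometry w g hg).IsSimplyConnected := by
  refine pathCoset_isSimplyConnected universalCoset_isConnected (edgeFamily w g hg).lift ?_
  rintro i _ ⟨x, rfl⟩
  refine ((edgeFamily w g hg).lift_toUniversal _ x).trans ?_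
  change baseEdge w g hg (ParabolicIndex.single i.castSucc).someMem * .inr _ *
    (baseEdge w g hg (ParabolicIndex.single i.castSucc).someMem)⁻¹ = _
  rw [ParabolicIndex.someMem_single, baseEdge, baseCoset_castSucc]
  rfl

end ParabolicEnvelope

/-! ### The covering -/

section ParabolicCovering

variable {X : Type u} {G : Type v} [Group G] [MulAction G X]

/-- The map from the universal coset pregeometry that sends the coset of `u` of type `i` to the
image of `w i` under `u`. -/
noncomputable def cosetMap (w : Fin 3 → X) (g : G) (hg : g • w 1 = w 1)
    (a : DiagramCosetElement (vertexSubgroup w g hg)) : X :=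
  naturalHom w g hg (Quotient.out a.2.2) • w a.1

variable {w : Fin 3 → X} {g : G} {hg : g • w 1 = w 1}

theorem cosetMap_cosetElement (i : Fin 3) (u : ParabolicEnvelope w g hg) :
    cosetMap w g hg (cosetElement _ i u) = naturalHom w g hg u • w i := by
  obtain ⟨l, hl⟩ := QuotientGroup.mk_out_eq_mul (vertexSubgroup w g hg i ()) u
  change naturalHom w g hg (Quotient.out (QuotientGroup.mk u : _ ⧸ vertexSubgroup w g hg i ())) •
    w i = _
  rw [hl, map_mul, mul_smul, naturalHom_smul_of_mem_vertexSubgroup l.2]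

theorem cosetMap_smul (u : ParabolicEnvelope w g hg)
    (a : DiagramCosetElement (vertexSubgroup w g hg)) :
    cosetMap w g hg (u • a) = naturalHom w g hg u • cosetMap w g hg a := by
  obtain ⟨i, x, rfl⟩ := exists_eq_cosetElement a
  rw [smul_cosetElement, cosetMap_cosetElement, cosetMap_cosetElement, map_mul, mul_smul]

variable {Γ : Pregeometry X (Fin 3)}

/-- Since the types `0` and `2` are not adjacent in the diagram, the residue of an element of
type `1` is a generalised digon. -/
theorem inc_of_inc_typ_one (hdiag : Γ.basicDiagram = SimpleGraph.pathGraph 3) {x y m : X}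
    (hx : Γ.typ x ≠ 1) (hy : Γ.typ y ≠ 1) (hxy : Γ.typ x ≠ Γ.typ y) (hm : Γ.typ m = 1)
    (hxm : Γ.Inc x m) (hmy : Γ.Inc m y) : Γ.Inc x y := by
  by_contra h
  have hadj : Γ.basicDiagram.Adj (Γ.typ x) (Γ.typ y) := by
    refine ⟨hxy, {m}, ?_, ?_, x, ⟨?_, ?_⟩, y, ⟨?_, ?_⟩, rfl, rfl, h⟩
    · rintro _ rfl _ rfl
      exact Γ.inc_refl _
    · rw [Set.image_singleton, hm]
      have key : ∀ i j : Fin 3, i ≠ 1 → j ≠ 1 → i ≠ j → ∀ k, k = 1 ↔ ¬ (k = i ∨ k = j) := by decide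
      ext k
      simpa using key _ _ hx hy hxy k
    · rintro rfl
      exact hx hm
    · rintro _ rfl
      exact hxm
    · rintro rfl
      exact hy hm
    · rintro _ rfl
      exact Γ.inc_symm hmy
  rw [hdiag, pathGraph_three_adj_iff] at hadj
  exact hadj.2.elim hx hy

section Hypotheses

variable (hgeom : Γ.IsGeometry) (hdiag : Γ.basicDiagram = SimpleGraph.pathGraph 3)
  (haut : Γ.ActsByAutomorphisms G)
  (hflag : ∀ i j, Γ.basicDiagram.Adj i j → Γ.IsFlagTransitiveOn G i j)
  (hw : ∀ i, Γ.typ (w i) = i) (hF : Γ.IsFlag (Set.range w))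
  (horb : {y | Γ.typ y = 2 ∧ Γ.Inc y (w 0) ∧ Γ.Inc y (w 1)} =
    MulAction.orbit ↥(MulAction.stabilizer G (w 0) ⊓ MulAction.stabilizer G (w 1)) (w 2) ∪
    MulAction.orbit ↥(MulAction.stabilizer G (w 0) ⊓ MulAction.stabilizer G (w 1)) (g • w 2))
  (hne : ¬ ∃ h : G, h • w 0 = w 0 ∧ h • w 2 = g • w 2)

include haut hw in
theorem typ_cosetMap (a : DiagramCosetElement (vertexSubgroup w g hg)) :
    Γ.typ (cosetMap w g hg a) = a.1 := by
  rw [cosetMap, (haut _).1, hw]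

include haut hF in
theorem cosetMap_inc_same (i j : Fin 3) (u : ParabolicEnvelope w g hg) :
    Γ.Inc (cosetMap w g hg (cosetElement _ i u)) (cosetMap w g hg (cosetElement _ j u)) := by
  rw [cosetMap_cosetElement, cosetMap_cosetElement, (haut _).2]
  exact hF _ ⟨i, rfl⟩ _ ⟨j, rfl⟩

include hdiag haut hw hF in
theorem cosetMap_inc {a b : DiagramCosetElement (vertexSubgroup w g hg)}
    (h : (universalCosetPregeometry w g hg).Inc a b) :
    Γ.Inc (cosetMap w g hg a) (cosetMap w g hg b) := by
  rcases pathCoset_inc_iff.1 h with rfl | ⟨i, j, z, -, rfl, rfl⟩ |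
    ⟨i, j, z, z', hij, h₂, rfl, h₃, rfl⟩
  · exact Γ.inc_refl _
  · exact cosetMap_inc_same haut hF i j z
  · have hi : i ≠ 1 := fun e => h₂ ((pathGraph_three_adj_iff _ _).2 ⟨hij, Or.inl e⟩)
    have hj : j ≠ 1 := fun e => h₂ ((pathGraph_three_adj_iff _ _).2 ⟨hij, Or.inr e⟩)
    have htyp := typ_cosetMap (hg := hg) haut hw
    refine inc_of_inc_typ_one hdiag (m := cosetMap w g hg (cosetElement _ 1 z)) ?_ ?_ ?_ (htyp _)
      (cosetMap_inc_same haut hF i 1 z) (h₃ ▸ cosetMap_inc_same haut hF 1 j z')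
    · rwa [htyp]
    · rwa [htyp]
    · rwa [htyp, htyp]

include hdiag haut hflag hw hF in
/-- Lifting along an edge of the diagram is a restatement of flag-transitivity. -/
theorem exists_cosetMap_lift_of_adj {i : Fin 3} {u : ParabolicEnvelope w g hg} {x : X}
    (hadj : (SimpleGraph.pathGraph 3).Adj i (Γ.typ x))
    (h : Γ.Inc (cosetMap w g hg (cosetElement _ i u)) x) :
    ∃ v, (universalCosetPregeometry w g hg).Inc (cosetElement _ i u)
      (cosetElement _ (Γ.typ x) v) ∧ cosetMap w g hg (cosetElement _ (Γ.typ x) v) = x := by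
  set j := Γ.typ x with hj
  have h' : Γ.Inc (w i) ((naturalHom w g hg u)⁻¹ • x) := by
    rw [← (haut (naturalHom w g hg u)).2, smul_inv_smul, ← cosetMap_cosetElement]
    exact h
  obtain ⟨l, hl₁, hl₂⟩ := hflag i j (hdiag ▸ hadj) (w i) (w j) (w i) _ (hw i) (hw j)
    (hF _ ⟨i, rfl⟩ _ ⟨j, rfl⟩) (hw i) ((haut _).1 x) h'
  obtain ⟨k, hk, rfl⟩ := exists_mem_vertexSubgroup (hg := hg) hl₁
  refine ⟨u * k, ?_, ?_⟩
  · have e : cosetElement (vertexSubgroup w g hg) i u = cosetElement _ i (u * k) :=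
      cosetElement_eq_iff.2 (by rwa [inv_mul_cancel_left])
    rw [e]
    exact pathCoset_inc_same i j _
  · rw [cosetMap_cosetElement, map_mul, mul_smul, hl₂, smul_inv_smul]

include hgeom hdiag haut hflag hw hF in
theorem exists_cosetMap_lift (a : DiagramCosetElement (vertexSubgroup w g hg)) (x : X)
    (h : Γ.Inc (cosetMap w g hg a) x) :
    ∃ b, (universalCosetPregeometry w g hg).Inc a b ∧ cosetMap w g hg b = x := by
  have htyp := typ_cosetMap (hg := hg) haut hw
  obtain ⟨i, u, rfl⟩ := exists_eq_cosetElement a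
  by_cases hi : i = Γ.typ x
  · exact ⟨_, (universalCosetPregeometry w g hg).inc_refl _,
      Γ.eq_of_inc h ((htyp _).trans hi)⟩
  by_cases hadj : (SimpleGraph.pathGraph 3).Adj i (Γ.typ x)
  · obtain ⟨v, hv⟩ := exists_cosetMap_lift_of_adj hdiag haut hflag hw hF hadj h
    exact ⟨_, hv⟩
  -- An incident pair of types `0`, `2` extends to a chamber, so that the lift can be done in two
  -- steps, through an element of type `1`.
  rw [pathGraph_three_adj_iff, not_and, not_or] at hadj
  obtain ⟨hi1, hx1⟩ := hadj hi
  obtain ⟨C, hC, hsub⟩ := hgeom {cosetMap w g hg (cosetElement _ i u), x} (by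
    rintro _ (rfl | rfl) _ (rfl | rfl)
    exacts [Γ.inc_refl _, h, Γ.inc_symm h, Γ.inc_refl _])
  obtain ⟨m, hmC, hm⟩ : 1 ∈ Γ.typ '' C := hC.2 ▸ Set.mem_univ _
  obtain ⟨v, hv, hvm⟩ := exists_cosetMap_lift_of_adj (g := g) (hg := hg) (u := u) (x := m)
    hdiag haut hflag hw hF ((pathGraph_three_adj_iff i _).2 ⟨hm ▸ hi1, Or.inr hm⟩)
    (hC.1 _ (hsub (Or.inl rfl)) m hmC)
  rw [hm] at hv hvm
  obtain ⟨v', hv', hvx⟩ := exists_cosetMap_lift_of_adj (g := g) (hg := hg) (u := v) (x := x)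
    (i := 1) hdiag haut hflag hw hF ((pathGraph_three_adj_iff 1 _).2 ⟨Ne.symm hx1, Or.inl rfl⟩)
    (by rw [hvm]; exact hC.1 m hmC x (hsub (Or.inr rfl)))
  exact ⟨_, pathCoset_inc_of_inc_one hi1 hx1 hi hv hv', hvx⟩

include hdiag haut hw hF horb in
/-- The normal form of an incident pair of types `0` and `2`: by the orbit hypothesis it is a
translate of the pair over `w 0`, `w 2` or of the pair over `w 0`, `g • w 2`. -/
theorem exists_of_universalCoset_inc_zero_two {u u' : ParabolicEnvelope w g hg}
    (h : (universalCosetPregeometry w g hg).Inc (cosetElement _ 0 u) (cosetElement _ 2 u')) :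
    ∃ z t, (t = 1 ∨ t = envelopeElement w g hg) ∧
      cosetElement (vertexSubgroup w g hg) 0 u = cosetElement _ 0 z ∧
      cosetElement (vertexSubgroup w g hg) 2 u' = cosetElement _ 2 (z * t) := by
  obtain ⟨x, x', h₁, h₂, h₃⟩ := exists_of_pathCoset_inc_zero_two h
  rw [h₁, h₃] at h ⊢
  obtain ⟨k, rfl⟩ : ∃ k, x' = x * k := ⟨x⁻¹ * x', by rw [mul_inv_cancel_left]⟩
  have hk : k ∈ vertexSubgroup w g hg 1 () := by
    have := cosetElement_eq_iff.1 h₂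
    rwa [inv_mul_cancel_left] at this
  have hk1 := naturalHom_smul_of_mem_vertexSubgroup hk
  have hmem1 : Γ.Inc (w 1) (naturalHom w g hg k • w 2) := by
    rw [← hk1, (haut _).2]
    exact hF _ ⟨1, rfl⟩ _ ⟨2, rfl⟩
  have hmem0 : Γ.Inc (w 0) (naturalHom w g hg k • w 2) := by
    have := cosetMap_inc hdiag haut hw hF h
    rwa [cosetMap_cosetElement, cosetMap_cosetElement, map_mul, mul_smul, (haut _).2] at this
  have hmem : naturalHom w g hg k • w 2 ∈
      {y | Γ.typ y = 2 ∧ Γ.Inc y (w 0) ∧ Γ.Inc y (w 1)} :=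
    ⟨by rw [(haut _).1, hw], Γ.inc_symm hmem0, Γ.inc_symm hmem1⟩
  have key : ∀ (t : ParabolicEnvelope w g hg), t ∈ vertexSubgroup w g hg 1 () →
      naturalHom w g hg k • w 2 ∈ MulAction.orbit
        ↥(MulAction.stabilizer G (w 0) ⊓ MulAction.stabilizer G (w 1))
        (naturalHom w g hg t • w 2) →
      ∃ z, cosetElement (vertexSubgroup w g hg) 0 x = cosetElement _ 0 z ∧
        cosetElement (vertexSubgroup w g hg) 2 (x * k) = cosetElement _ 2 (z * t) := by
    rintro t ht ⟨⟨l, hl0, hl1⟩, hl⟩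
    change l • naturalHom w g hg t • w 2 = _ at hl
    obtain ⟨d, hd, rfl⟩ := exists_mem_vertexSubgroup (hg := hg) (i := 0) hl0
    have hd1 : d ∈ vertexSubgroup w g hg 1 () :=
      (mem_stabilizerImage_iff (i := 0) (j := 1) (by decide) hl0 hl1).1 hd
    refine ⟨x * d, cosetElement_eq_iff.2 (by rwa [inv_mul_cancel_left]), ?_⟩
    rw [cosetElement_eq_iff, mul_inv_rev, mul_assoc, mul_assoc x, inv_mul_cancel_left]
    have hm : k⁻¹ * (d * t) ∈ vertexSubgroup w g hg 1 () := mul_mem (inv_mem hk) (mul_mem hd1 ht)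
    refine (mem_stabilizerImage_iff (i := 1) (j := 2) (by decide)
      (naturalHom_smul_of_mem_vertexSubgroup hm) ?_).1 hm
    change naturalHom w g hg _ • w 2 = w 2
    rw [map_mul, map_mul, mul_smul, mul_smul, hl, map_inv, inv_smul_smul]
  rw [horb] at hmem
  rcases hmem with hmem | hmem
  · obtain ⟨z, hz⟩ := key 1 (one_mem _) (by rwa [map_one, one_smul])
    exact ⟨z, 1, Or.inl rfl, hz⟩
  · obtain ⟨z, hz⟩ := key _ envelopeElement_mem (by rwa [naturalHom_envelopeElement])
    exact ⟨z, _, Or.inr rfl, hz⟩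

include hne in
/-- Two pairs in normal form with the same image have equal elements of type `0` if and only if
they have equal elements of type `2`. As `(w 0, w 2)` and `(w 0, g • w 2)` are in different orbits,
both pairs are over the same one, and the stabiliser of it is a member of the amalgam. -/
theorem cosetElement_zero_eq_iff_two_eq {x x' t t' : ParabolicEnvelope w g hg}
    (ht : t = 1 ∨ t = envelopeElement w g hg) (ht' : t' = 1 ∨ t' = envelopeElement w g hg)
    (h₀ : cosetMap w g hg (cosetElement _ 0 x) = cosetMap w g hg (cosetElement _ 0 x'))
    (h₂ : cosetMap w g hg (cosetElement _ 2 (x * t)) =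
      cosetMap w g hg (cosetElement _ 2 (x' * t'))) :
    cosetElement (vertexSubgroup w g hg) 0 x = cosetElement _ 0 x' ↔
      cosetElement (vertexSubgroup w g hg) 2 (x * t) = cosetElement _ 2 (x' * t') := by
  rw [cosetElement_eq_iff, cosetElement_eq_iff]
  obtain ⟨y, rfl⟩ : ∃ y, x' = x * y := ⟨x⁻¹ * x', by rw [mul_inv_cancel_left]⟩
  simp only [cosetMap_cosetElement, map_mul, mul_smul, smul_left_cancel_iff] at h₀ h₂
  rw [inv_mul_cancel_left, mul_inv_rev, mul_assoc x, mul_assoc t⁻¹, inv_mul_cancel_left]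
  rcases ht with rfl | rfl <;> rcases ht' with rfl | rfl
  · rw [map_one, one_smul] at h₂
    rw [inv_one, one_mul, mul_one]
    exact mem_stabilizerImage_iff (i := 0) (j := 2) (by decide) h₀.symm h₂.symm
  · rw [map_one, one_smul, naturalHom_envelopeElement] at h₂
    refine absurd ⟨(naturalHom w g hg y)⁻¹, ?_, ?_⟩ hne
    · rw [inv_smul_eq_iff]
      exact h₀
    · rw [inv_smul_eq_iff]
      exact h₂
  · rw [map_one, one_smul, naturalHom_envelopeElement] at h₂
    exact absurd ⟨naturalHom w g hg y, h₀.symm, h₂.symm⟩ hne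
  · rw [naturalHom_envelopeElement] at h₂
    rw [← mul_assoc]
    exact (mem_stabilizerImage_iff (i := 0) (j := 3) (by decide) h₀.symm h₂.symm).trans
      mem_stabilizerImage_three_iff

include hdiag haut hw hF horb hne in
/-- Injectivity on the elements incident with `a`. For adjacent types, two cosets incident with `a`
differ by an element of the image of a vertex stabiliser, and the images of the stabilisers of two
incident base elements meet as the stabilisers do in `G`. For the types `0` and `2`, both incident
pairs are brought into normal form. -/
theorem cosetMap_injOn {a b c : DiagramCosetElement (vertexSubgroup w g hg)}
    (hab : (universalCosetPregeometry w g hg).Inc a b)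
    (hac : (universalCosetPregeometry w g hg).Inc a c)
    (h : cosetMap w g hg b = cosetMap w g hg c) : b = c := by
  have htyp := typ_cosetMap (hg := hg) haut hw
  have hbc : b.1 = c.1 := by rw [← htyp, ← htyp, h]
  obtain ⟨i, u, rfl⟩ := exists_eq_cosetElement a
  obtain ⟨j, x, rfl⟩ := exists_eq_cosetElement b
  obtain ⟨k, y, rfl⟩ := exists_eq_cosetElement c
  obtain rfl : j = k := hbc
  by_cases hij : i = j
  · exact ((universalCosetPregeometry w g hg).eq_of_inc hab hij).symm.trans
      ((universalCosetPregeometry w g hg).eq_of_inc hac hij)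
  by_cases hadj : (SimpleGraph.pathGraph 3).Adj i j
  · obtain ⟨z, hz₁, hz₂⟩ := exists_of_pathCoset_inc hadj hab
    obtain ⟨z', hz₁', hz₂'⟩ := exists_of_pathCoset_inc hadj hac
    rw [hz₂, hz₂'] at h ⊢
    rw [hz₁] at hz₁'
    have hmem := cosetElement_eq_iff.1 hz₁'
    rw [cosetMap_cosetElement, cosetMap_cosetElement, ← inv_smul_eq_iff, ← map_inv, ← mul_smul,
      ← map_mul] at h
    have hmem' := (mem_stabilizerImage_iff (i := i.castSucc) (j := j.castSucc)
      (by clear * -; revert i j; decide) (naturalHom_smul_of_mem hmem) ?_).1 hmem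
    · exact cosetElement_eq_iff.2 hmem'
    · rw [parabolicElement_castSucc, map_mul, mul_smul, map_inv, inv_smul_eq_iff]
      rw [map_mul, mul_smul, map_inv, inv_smul_eq_iff] at h
      exact h.symm
  rw [pathGraph_three_adj_iff] at hadj
  obtain ⟨rfl, rfl⟩ | ⟨rfl, rfl⟩ : (i = 0 ∧ j = 2) ∨ (i = 2 ∧ j = 0) := by
    clear * - hij hadj
    revert i j
    decide
  · obtain ⟨z, t, ht, hz₁, hz₂⟩ :=
      exists_of_universalCoset_inc_zero_two hdiag haut hw hF horb hab
    obtain ⟨z', t', ht', hz₁', hz₂'⟩ :=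
      exists_of_universalCoset_inc_zero_two hdiag haut hw hF horb hac
    rw [hz₂, hz₂'] at h ⊢
    rw [hz₁] at hz₁'
    exact (cosetElement_zero_eq_iff_two_eq hne ht ht' (congrArg _ hz₁') h).1 hz₁'
  · obtain ⟨z, t, ht, hz₁, hz₂⟩ := exists_of_universalCoset_inc_zero_two hdiag haut hw hF horb
      ((universalCosetPregeometry w g hg).inc_symm hab)
    obtain ⟨z', t', ht', hz₁', hz₂'⟩ := exists_of_universalCoset_inc_zero_two hdiag haut hw hF horb
      ((universalCosetPregeometry w g hg).inc_symm hac)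
    rw [hz₁, hz₁'] at h ⊢
    rw [hz₂] at hz₂'
    exact (cosetElement_zero_eq_iff_two_eq hne ht ht' h (congrArg _ hz₂')).2 hz₂'

include hgeom hdiag haut hflag hw hF horb hne in
theorem inc_of_cosetMap_inc {a b c : DiagramCosetElement (vertexSubgroup w g hg)}
    (hab : (universalCosetPregeometry w g hg).Inc a b)
    (hac : (universalCosetPregeometry w g hg).Inc a c)
    (h : Γ.Inc (cosetMap w g hg b) (cosetMap w g hg c)) :
    (universalCosetPregeometry w g hg).Inc b c := by
  have htyp := typ_cosetMap (hg := hg) haut hw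
  by_cases h₁ : a.1 = b.1
  · rwa [← (universalCosetPregeometry w g hg).eq_of_inc hab h₁]
  by_cases h₂ : a.1 = c.1
  · rw [← (universalCosetPregeometry w g hg).eq_of_inc hac h₂]
    exact (universalCosetPregeometry w g hg).inc_symm hab
  by_cases h₃ : b.1 = c.1
  · rw [cosetMap_injOn hdiag haut hw hF horb hne hab hac
      (Γ.eq_of_inc h (by rw [htyp, htyp, h₃]))]
    exact (universalCosetPregeometry w g hg).inc_refl c
  -- If `b` has type `1`, then the lift at `b` of the image of `c` is incident with `a`, hence
  -- equal to `c`.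
  have key : ∀ {b c : DiagramCosetElement (vertexSubgroup w g hg)},
      (universalCosetPregeometry w g hg).Inc a b → (universalCosetPregeometry w g hg).Inc a c →
      Γ.Inc (cosetMap w g hg b) (cosetMap w g hg c) → a.1 ≠ b.1 → a.1 ≠ c.1 → b.1 ≠ c.1 →
      b.1 = 1 → (universalCosetPregeometry w g hg).Inc b c := by
    intro b c hab hac h h₁ h₂ h₃ hb
    obtain ⟨d, hbd, hd⟩ := exists_cosetMap_lift hgeom hdiag haut hflag hw hF b _ h
    have hdc : d.1 = c.1 := by rw [← htyp, ← htyp, hd]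
    have had : (universalCosetPregeometry w g hg).Inc a d := by
      obtain ⟨i, x, rfl⟩ := exists_eq_cosetElement a
      obtain ⟨j, y, rfl⟩ := exists_eq_cosetElement b
      obtain ⟨k, z, rfl⟩ := exists_eq_cosetElement d
      obtain rfl : j = 1 := hb
      exact pathCoset_inc_of_inc_one h₁ (fun e => h₃ (e.symm.trans hdc))
        (fun e => h₂ (e.trans hdc)) hab hbd
    rwa [← cosetMap_injOn hdiag haut hw hF horb hne had hac hd]
  by_cases hb : b.1 = 1
  · exact key hab hac h h₁ h₂ h₃ hb
  by_cases hc : c.1 = 1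
  · exact (universalCosetPregeometry w g hg).inc_symm
      (key hac hab (Γ.inc_symm h) h₂ h₁ (Ne.symm h₃) hc)
  have ha : a.1 = 1 := by
    have h : ∀ i j k : Fin 3, i = 1 ∨ i = j ∨ i = k ∨ j = k ∨ j = 1 ∨ k = 1 := by decide
    exact (h a.1 b.1 c.1).resolve_right (by
      rintro (h | h | h | h | h)
      exacts [h₁ h, h₂ h, h₃ h, hb h, hc h])
  obtain ⟨i, x, rfl⟩ := exists_eq_cosetElement a
  obtain ⟨j, y, rfl⟩ := exists_eq_cosetElement b
  obtain ⟨k, z, rfl⟩ := exists_eq_cosetElement c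
  obtain rfl : i = 1 := ha
  exact pathCoset_inc_of_inc_one hb hc h₃ ((universalCosetPregeometry w g hg).inc_symm hab) hac

include hgeom hdiag haut hflag hw hF horb hne in
theorem cosetMap_isCovering (hconn : Γ.IsConnected) :
    Pregeometry.IsCovering (universalCosetPregeometry w g hg) Γ (cosetMap w g hg) := by
  have : Nonempty (DiagramCosetElement (vertexSubgroup w g hg)) := ⟨cosetElement _ 0 1⟩
  have hlift := exists_cosetMap_lift (hg := hg) hgeom hdiag haut hflag hw hF
  exact Pregeometry.isCovering_of_lift (typ_cosetMap haut hw)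
    (fun a b => cosetMap_inc hdiag haut hw hF)
    (Pregeometry.surjective_of_lift hconn hlift) hlift
    fun a b c => inc_of_cosetMap_inc hgeom hdiag haut hflag hw hF horb hne

include haut hw in
theorem naturalHom_surjective (hsurj : Function.Surjective (cosetMap w g hg)) :
    Function.Surjective (naturalHom w g hg) := by
  intro h
  obtain ⟨a, ha⟩ := hsurj (h • w 0)
  have h0 : a.1 = 0 := by rw [← typ_cosetMap haut hw a, ha, (haut h).1, hw]
  obtain ⟨i, u, rfl⟩ := exists_eq_cosetElement a
  obtain rfl : i = 0 := h0
  rw [cosetMap_cosetElement] at ha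
  obtain ⟨l, -, hl⟩ := exists_mem_vertexSubgroup (hg := hg) (i := 0)
    (h := (naturalHom w g hg u)⁻¹ * h) (by rw [mul_smul, ← ha, inv_smul_smul])
  exact ⟨u * l, by rw [map_mul, hl, mul_inv_cancel_left]⟩

include haut hw in
/-- The kernel of the natural homomorphism is transitive on the fibres of the covering. -/
theorem exists_smul_eq_of_cosetMap_eq {a b : DiagramCosetElement (vertexSubgroup w g hg)}
    (h : cosetMap w g hg a = cosetMap w g hg b) : ∃ u, naturalHom w g hg u = 1 ∧ u • a = b := by
  have hab : a.1 = b.1 := by rw [← typ_cosetMap haut hw a, h, typ_cosetMap haut hw]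
  obtain ⟨i, x, rfl⟩ := exists_eq_cosetElement a
  obtain ⟨j, y, rfl⟩ := exists_eq_cosetElement b
  obtain rfl : i = j := hab
  rw [cosetMap_cosetElement, cosetMap_cosetElement] at h
  obtain ⟨l, hl, hl'⟩ := exists_mem_vertexSubgroup (hg := hg) (i := i)
    (h := (naturalHom w g hg y)⁻¹ * naturalHom w g hg x) (by rw [mul_smul, h, inv_smul_smul])
  refine ⟨y * l * x⁻¹, ?_, ?_⟩
  · rw [map_mul, map_mul, hl', mul_inv_cancel_left, map_inv, mul_inv_cancel]
  · rw [smul_cosetElement, inv_mul_cancel_right]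
    exact (cosetElement_eq_iff.2 (by rwa [inv_mul_cancel_left])).symm

end Hypotheses

/-- The kernel of the natural homomorphism is semiregular, since the homomorphism is injective on
the vertex stabilisers. -/
theorem eq_one_of_smul_eq {u : ParabolicEnvelope w g hg} (hu : naturalHom w g hg u = 1)
    {a : DiagramCosetElement (vertexSubgroup w g hg)} (h : u • a = a) : u = 1 := by
  obtain ⟨i, x, rfl⟩ := exists_eq_cosetElement a
  have hmem := cosetElement_eq_iff.1 ((smul_cosetElement u x i).symm.trans h).symm
  have h1 := eq_one_of_mem_vertexSubgroup hmem (by simp [hu])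
  rw [inv_mul_eq_one] at h1
  exact (mul_eq_right.1 h1.symm)

end ParabolicCovering

theorem mainTheorem2 {X : Type u} {G : Type v} [Group G] [MulAction G X] [FaithfulSMul G X]
    (Γ : Pregeometry X (Fin 3)) (hgeom : Γ.IsGeometry) (hconn : Γ.IsConnected)
    (hsum : Γ.DirectSumProperty) (hdiag : Γ.basicDiagram = SimpleGraph.pathGraph 3)
    (haut : Γ.ActsByAutomorphisms G) (hvert : Γ.IsVertexTransitive G)
    (hflag : ∀ i j, Γ.basicDiagram.Adj i j → Γ.IsFlagTransitiveOn G i j)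
    (w : Fin 3 → X) (hw : ∀ i, Γ.typ (w i) = i) (hF : Γ.IsFlag (Set.range w))
    (g : G) (hg : g • w 1 = w 1)
    (horb : {y | Γ.typ y = 2 ∧ Γ.Inc y (w 0) ∧ Γ.Inc y (w 1)} =
      MulAction.orbit ↥(MulAction.stabilizer G (w 0) ⊓ MulAction.stabilizer G (w 1)) (w 2) ∪
      MulAction.orbit ↥(MulAction.stabilizer G (w 0) ⊓ MulAction.stabilizer G (w 1)) (g • w 2))
    (hne : ¬ ∃ h : G, h • w 0 = w 0 ∧ h • w 2 = g • w 2) :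
    (universalCosetPregeometry w g hg).IsGeometry ∧
    (universalCosetPregeometry w g hg).IsSimplyConnected ∧
    Function.Surjective (naturalHom w g hg) ∧
    (∃ π : DiagramCosetElement (vertexSubgroup w g hg) → X,
      (∀ (i : Fin 3) (a : (fusedAmalgamOfParabolics w g hg).UniversalEnvelopingGroup),
        π ⟨i, (), QuotientGroup.mk a⟩ = naturalHom w g hg a • w i) ∧
      Pregeometry.IsUniversalCovering.{u, v, w} (universalCosetPregeometry w g hg) Γ π) ∧
    ∀ x : X, ∃ S : GroupExtension (Γ.FundamentalGroup x)
      (fusedAmalgamOfParabolics w g hg).UniversalEnvelopingGroup G,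
      S.rightHom = naturalHom w g hg := by
  have hcov := cosetMap_isCovering (hg := hg) hgeom hdiag haut hflag hw hF horb hne hconn
  have hsc := universalCoset_isSimplyConnected (w := w) (g := g) (hg := hg)
  have hsurj := naturalHom_surjective haut hw hcov.surjective
  have : Nonempty (DiagramCosetElement (vertexSubgroup w g hg)) := ⟨cosetElement _ 0 1⟩
  refine ⟨hcov.isGeometry hgeom, hsc, hsurj, ⟨cosetMap w g hg, cosetMap_cosetElement,
    hcov.isUniversalCovering hsc⟩, fun x => ?_⟩
  exact hcov.exists_groupExtension hsc pathCoset_actsByAutomorphisms (naturalHom w g hg) hsurj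
    (fun u hu a => by rw [cosetMap_smul, hu, one_smul]) (fun u hu a => eq_one_of_smul_eq hu)
    (fun a b => exists_smul_eq_of_cosetMap_eq haut hw) x
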